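/- Let $\mathbb D=\{z\in\mathbb C:|z|<1\}$, let $\beta=(\beta_n)_{n\ge 0}$ be a sequence of positive real numbers, and let $H^2(\beta)$ be the weighted Hardy space of all holomorphic functions $f(z)=\sum_{n\ge 0}a_nz^n$ on $\mathbb D$ with finite norm $\|f\|_\beta=\bigl(\sum_{n\ge0}|a_n|^2\beta_n^2\bigr)^{1/2}$. Suppose that the sequence $(\beta_n/\sqrt n)_{n\ge1}$ is (weakly) decreasing, that $\beta_0\ge\beta_1$, and that $$\sup_{n}\; n\left|1-\frac{\beta_{n+1}}{\beta_n}\right|<\infty .$$ Then: 1. Every holomorphic flow generates a quasicontractive $C_0$-semigroup of composition operators on $H^2(\beta)$. That is, let $(\phi_t)_{t\ge0}$ be a family of holomorphic maps $\mathbb D\to\mathbb D$ with $\phi_0(z)=z$, $\phi_{t+s}=\phi_t\circ\phi_s$ for $t,s\ge0$, and $\lim_{t\to s}\phi_t(z)=\phi_s(z)$ for all $s\ge 0$, $z\in\mathbb D$. Then $T_tf=f\circ\phi_t$ ($t\ge0$) are bounded operators on $H^2(\beta)$ that form a $C_0$-semigroup, and there is $\omega\in\mathbb R$ with $\|T_t\|\le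 e^{\omega t}$ for all $t\ge0$. 2. There is a constant $a\ge0$ (depending only on $\beta$) such that for every univalent (holomorphic and injective) map $\phi:\mathbb D\to\mathbb D$ the operator $C_\phi f=f\circ\phi$ is bounded on $H^2(\beta)$ and $$\|C_\phi\|\le\left(\frac{1+|\phi(0)|}{1-|\phi(0)|}\right)^{a}.$$ Moreover, this estimate holds, for all univalent $\phi:\mathbb D\to\mathbb D$, with any constant $a\ge0$ such that, for all $r\in(0,1)$ and $\alpha_r(z)=\frac{z+r}{1+rz}$, the operator $C_{\alpha_r}$ is bounded on $H^2(\beta)$ and $\|C_{\alpha_r}\|\le\left(\frac{1+r}{1-r}\right)^{a}$. -/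

import Mathlib

open Filter Topology Complex.UnitDisc
open scoped NNReal ENNReal

noncomputable section

namespace WeightedHardy

/-- Extension by zero to `ℂ` of a function on the open unit disc. -/
def extendZero (f : 𝔻 → ℂ) (z : ℂ) : ℂ :=
  if h : ‖z‖ < 1 then f (Complex.UnitDisc.mk z h) else 0

theorem extendZero_coe (f : 𝔻 → ℂ) (z : 𝔻) : extendZero f z = f z := by
  simp [extendZero, z.norm_lt_one]

theorem extendZero_add (f g : 𝔻 → ℂ) : extendZero (f + g) = extendZero f + extendZero g := by
  funext z
  by_cases h : ‖z‖ < 1 <;> simp [extendZero, h]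

theorem extendZero_smul (c : ℂ) (f : 𝔻 → ℂ) : extendZero (c • f) = c • extendZero f := by
  funext z
  by_cases h : ‖z‖ < 1 <;> simp [extendZero, h]

/-- `f : 𝔻 → ℂ` is holomorphic on the open unit disc. -/
def IsHol (f : 𝔻 → ℂ) : Prop :=
  DifferentiableOn ℂ (extendZero f) (Metric.ball 0 1)

/-- The `n`-th Taylor coefficient at `0`, i.e. `a_n` in `f z = ∑ a_n z ^ n`. -/
def taylorCoeff (f : 𝔻 → ℂ) (n : ℕ) : ℂ :=
  iteratedDeriv n (extendZero f) 0 / (n.factorial : ℂ)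

theorem IsHol.add {f g : 𝔻 → ℂ} (hf : IsHol f) (hg : IsHol g) : IsHol (f + g) := by
  unfold IsHol
  rw [extendZero_add]
  exact DifferentiableOn.add hf hg

theorem IsHol.smul {f : 𝔻 → ℂ} (hf : IsHol f) (c : ℂ) : IsHol (c • f) := by
  unfold IsHol
  rw [extendZero_smul]
  exact DifferentiableOn.const_smul hf c

theorem isHol_zero : IsHol 0 := by
  have : extendZero 0 = fun _ => (0 : ℂ) := by
    funext z
    by_cases h : ‖z‖ < 1 <;> simp [extendZero, h]
  unfold IsHol
  rw [this]
  exact differentiableOn_const 0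

theorem IsHol.contDiffAt {f : 𝔻 → ℂ} (hf : IsHol f) (n : ℕ) :
    ContDiffAt ℂ n (extendZero f) 0 :=
  (DifferentiableOn.analyticAt hf (Metric.ball_mem_nhds 0 one_pos)).contDiffAt

theorem taylorCoeff_add {f g : 𝔻 → ℂ} (hf : IsHol f) (hg : IsHol g) (n : ℕ) :
    taylorCoeff (f + g) n = taylorCoeff f n + taylorCoeff g n := by
  unfold taylorCoeff
  rw [extendZero_add, iteratedDeriv_add (hf.contDiffAt n) (hg.contDiffAt n), add_div]

theorem taylorCoeff_smul (c : ℂ) (f : 𝔻 → ℂ) (n : ℕ) :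
    taylorCoeff (c • f) n = c * taylorCoeff f n := by
  unfold taylorCoeff
  rw [extendZero_smul, iteratedDeriv_const_smul_field, smul_eq_mul, mul_div_assoc]

theorem taylorCoeff_zero (n : ℕ) : taylorCoeff 0 n = 0 := by
  simpa using taylorCoeff_smul 0 0 n

/-- A holomorphic function on the disc is the sum of its Taylor series. -/
theorem IsHol.hasSum {f : 𝔻 → ℂ} (hf : IsHol f) (z : 𝔻) :
    HasSum (fun n : ℕ => taylorCoeff f n * (z : ℂ) ^ n) (f z) := by
  have h := Complex.hasSum_taylorSeries_on_ball (c := 0) (r := 1) hf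
    (z := (z : ℂ)) (by simpa using z.norm_lt_one)
  rw [extendZero_coe] at h
  refine h.congr_fun fun n => ?_
  simp only [taylorCoeff, sub_zero, smul_eq_mul]
  ring

/-- A sequence of positive weights `β_0, β_1, …`. -/
abbrev Weight := ℕ → {b : ℝ // 0 < b}

/-- The Taylor coefficients of `f`, multiplied by the weights. -/
def weightedCoeff (β : Weight) (f : 𝔻 → ℂ) (n : ℕ) : ℂ :=
  ((β n : ℝ) : ℂ) * taylorCoeff f n

theorem weightedCoeff_add (β : Weight) {f g : 𝔻 → ℂ} (hf : IsHol f) (hg : IsHol g) :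
    weightedCoeff β (f + g) = weightedCoeff β f + weightedCoeff β g := by
  funext n
  simp [weightedCoeff, taylorCoeff_add hf hg, mul_add]

theorem weightedCoeff_smul (β : Weight) (c : ℂ) (f : 𝔻 → ℂ) :
    weightedCoeff β (c • f) = c • weightedCoeff β f := by
  funext n
  simp [weightedCoeff, taylorCoeff_smul, mul_left_comm]

theorem memℓp_weightedCoeff_iff (β : Weight) (f : 𝔻 → ℂ) :
    Memℓp (weightedCoeff β f) 2 ↔
      Summable fun n => ‖taylorCoeff f n‖ ^ 2 * (β n : ℝ) ^ 2 := by
  rw [memℓp_gen_iff (by norm_num)]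
  refine summable_congr fun n => ?_
  simp [weightedCoeff, mul_pow, mul_comm]

/-- The holomorphic functions `f z = ∑ a_n z ^ n` on the disc with
`∑ |a_n| ^ 2 β_n ^ 2 < ∞`, as a linear subspace of the functions on the disc. -/
def submodule (β : Weight) : Submodule ℂ (𝔻 → ℂ) where
  carrier := {f | IsHol f ∧ Summable fun n => ‖taylorCoeff f n‖ ^ 2 * (β n : ℝ) ^ 2}
  zero_mem' := ⟨isHol_zero, by simp [taylorCoeff_zero]⟩
  add_mem' := by
    rintro f g ⟨hf, hf2⟩ ⟨hg, hg2⟩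
    refine ⟨hf.add hg, ?_⟩
    rw [← memℓp_weightedCoeff_iff] at *
    rw [weightedCoeff_add β hf hg]
    exact hf2.add hg2
  smul_mem' := by
    rintro c f ⟨hf, hf2⟩
    refine ⟨hf.smul c, ?_⟩
    rw [← memℓp_weightedCoeff_iff] at *
    rw [weightedCoeff_smul]
    exact hf2.const_smul c

/-- The weighted Hardy space `H²(β)`. It is a type of its own, so that its topology is the one
of the norm defined below and not the topology of pointwise convergence. -/
def H2 (β : Weight) : Type := ↥(submodule β)

namespace H2

variable {β : Weight}

instance : AddCommGroup (H2 β) := inferInstanceAs (AddCommGroup ↥(submodule β))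

instance : Module ℂ (H2 β) := inferInstanceAs (Module ℂ ↥(submodule β))

instance : CoeFun (H2 β) (fun _ => 𝔻 → ℂ) := ⟨Subtype.val⟩

/-- The embedding `f ↦ (β_n a_n)` of `H²(β)` into `ℓ²`. -/
def toLp (β : Weight) : H2 β →ₗ[ℂ] lp (fun _ : ℕ => ℂ) 2 where
  toFun f := ⟨weightedCoeff β f, (memℓp_weightedCoeff_iff β f).2 f.2.2⟩
  map_add' f g := Subtype.ext (weightedCoeff_add β f.2.1 g.2.1)
  map_smul' c f := Subtype.ext (weightedCoeff_smul β c f)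

theorem toLp_injective : Function.Injective (toLp β) := by
  intro f g h
  have hc : taylorCoeff f = taylorCoeff g := by
    funext n
    have := congrFun (congrArg Subtype.val h) n
    exact mul_left_cancel₀ (by exact_mod_cast (β n).2.ne') this
  refine Subtype.ext (funext fun z => ?_)
  have h1 := f.2.1.hasSum z
  have h2 := g.2.1.hasSum z
  rw [hc] at h1
  exact h1.unique h2

/-- The norm of `H²(β)`; `H2.norm_eq` is the explicit formula. -/
instance : NormedAddCommGroup (H2 β) :=
  NormedAddCommGroup.induced (H2 β) (lp (fun _ : ℕ => ℂ) 2) (toLp β) toLp_injective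

instance : NormedSpace ℂ (H2 β) :=
  NormedSpace.induced ℂ (H2 β) (lp (fun _ : ℕ => ℂ) 2) (toLp β)

theorem norm_eq (f : H2 β) :
    ‖f‖ = Real.sqrt (∑' n, ‖taylorCoeff f n‖ ^ 2 * (β n : ℝ) ^ 2) := by
  have h : ‖f‖ = ‖toLp β f‖ := rfl
  rw [h, lp.norm_eq_tsum_rpow (by norm_num), Real.sqrt_eq_rpow]
  simp [toLp, weightedCoeff, mul_pow, mul_comm]

end H2

/-- The operator `C` on `H²(β)` is the composition operator `C_φ f = f ∘ φ`. -/
def IsCompositionOperator {β : Weight} (C : H2 β →L[ℂ] H2 β) (φ : 𝔻 → 𝔻) : Prop :=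
  ∀ (f : H2 β) (z : 𝔻), C f z = f (φ z)

/-- A holomorphic flow in the open unit disc. -/
structure IsHolomorphicFlow (φ : ℝ≥0 → 𝔻 → 𝔻) : Prop where
  isHol : ∀ t, IsHol fun z => (φ t z : ℂ)
  zero : ∀ z, φ 0 z = z
  add : ∀ t s z, φ (t + s) z = φ t (φ s z)
  tendsto : ∀ s z, Tendsto (fun t => φ t z) (𝓝 s) (𝓝 (φ s z))

/-- A `C₀`-semigroup of bounded operators. -/
structure IsC0Semigroup {E : Type*} [NormedAddCommGroup E] [NormedSpace ℂ E]
    (T : ℝ≥0 → E →L[ℂ] E) : Prop where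
  zero : T 0 = ContinuousLinearMap.id ℂ E
  add : ∀ t s, T (t + s) = (T t).comp (T s)
  tendsto : ∀ f, Tendsto (fun t => T t f) (𝓝[>] 0) (𝓝 f)

/-- Quasicontractivity: `‖T_t‖ ≤ e ^ (ω t)` for all `t ≥ 0`, for some real `ω`. -/
def IsQuasicontractive {E : Type*} [NormedAddCommGroup E] [NormedSpace ℂ E]
    (T : ℝ≥0 → E →L[ℂ] E) : Prop :=
  ∃ ω : ℝ, ∀ t : ℝ≥0, ‖T t‖ ≤ Real.exp (ω * t)

/-- The family `φ_t` generates a quasicontractive (`C₀`-)semigroup of composition operators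
`T_t f = f ∘ φ_t` on `H²(β)`. -/
def GeneratesQuasicontractive (β : Weight) (φ : ℝ≥0 → 𝔻 → 𝔻) : Prop :=
  ∃ T : ℝ≥0 → H2 β →L[ℂ] H2 β,
    (∀ t, IsCompositionOperator (T t) (φ t)) ∧ IsC0Semigroup T ∧ IsQuasicontractive T

/-- A univalent (holomorphic and injective) self-map of the disc. -/
def IsUnivalent (φ : 𝔻 → 𝔻) : Prop :=
  IsHol (fun z => (φ z : ℂ)) ∧ Function.Injective φ

/-- `C_φ` is a bounded operator on `H²(β)` with
`‖C_φ‖ ≤ ((1 + |φ 0|) / (1 - |φ 0|)) ^ a`. -/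
def HasCompositionBound (β : Weight) (a : ℝ) (φ : 𝔻 → 𝔻) : Prop :=
  ∃ C : H2 β →L[ℂ] H2 β, IsCompositionOperator C φ ∧
    ‖C‖ ≤ ((1 + ‖(φ 0 : ℂ)‖) / (1 - ‖(φ 0 : ℂ)‖)) ^ a

theorem norm_mobius_lt_one {r : ℝ} (hr : r ∈ Set.Ioo (0 : ℝ) 1) (z : 𝔻) :
    ‖((z : ℂ) + r) / (1 + r * z)‖ < 1 := by
  have hz := z.normSq_lt_one
  have key : Complex.normSq ((z : ℂ) + r) < Complex.normSq (1 + r * (z : ℂ)) := by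
    rw [Complex.normSq_apply] at *
    simp [Complex.normSq_apply] at *
    nlinarith [hr.1, hr.2, mul_pos (sub_pos.2 hz)
      (mul_pos (sub_pos.2 hr.2) (by linarith [hr.1] : (0 : ℝ) < 1 + r))]
  have hlt : ‖(z : ℂ) + r‖ < ‖1 + r * (z : ℂ)‖ := by
    rw [Complex.normSq_eq_norm_sq, Complex.normSq_eq_norm_sq] at key
    exact lt_of_pow_lt_pow_left₀ 2 (norm_nonneg _) key
  rw [norm_div, div_lt_one (lt_of_le_of_lt (norm_nonneg _) hlt)]
  exact hlt

/-- The disc automorphism `α_r z = (z + r) / (1 + r z)`, for `0 < r < 1`. -/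
def mobius (r : ℝ) (hr : r ∈ Set.Ioo (0 : ℝ) 1) (z : 𝔻) : 𝔻 :=
  Complex.UnitDisc.mk (((z : ℂ) + r) / (1 + r * z)) (norm_mobius_lt_one hr z)

/-- `C_{α_r}` is bounded on `H²(β)` with `‖C_{α_r}‖ ≤ ((1 + r) / (1 - r)) ^ a`,
for all `0 < r < 1`. -/
def MobiusEstimate (β : Weight) (a : ℝ) : Prop :=
  ∀ (r : ℝ) (hr : r ∈ Set.Ioo (0 : ℝ) 1),
    ∃ C : H2 β →L[ℂ] H2 β, IsCompositionOperator C (mobius r hr) ∧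
      ‖C‖ ≤ ((1 + r) / (1 - r)) ^ a

end WeightedHardy

end

/-! ### Power series on the disc: uniqueness, Cauchy estimates, composition -/

namespace WeightedHardy

/-! The proof rests on three facts.

Univalent maps fixing the origin are contractions (`IsUnivalent.exists_contraction`). For a
polynomial `p` and univalent `φ`, a change of variables turns the area integral of `|(p ∘ φ)'|²`
into that of `|p'|²` over `φ(𝔻) ⊆ 𝔻`, so it does not increase. If `φ 0 = 0`, the coefficients of `f
∘ φ` up to degree `n` depend only on those of `f` up to degree `n`. Applying the area bound to every
Taylor polynomial of `f` therefore compares all partial sums of `∑ k |a_k|²`. Abel summation against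
the decreasing weights `β_k² / k` gives the norm inequality; the constant coefficient is unchanged.

Every univalent `φ` with `φ 0 ≠ 0` factors as rotation ∘ `α_r` ∘ `ψ`, with `r = |φ 0|` and `ψ`
univalent fixing the origin. Hence any estimate for the `α_r` passes to `φ` with the same exponent
(`IsUnivalent.hasCompositionBound`). That some exponent works is an energy estimate
(`exists_mobiusEstimate`). Since `∂α_r/∂r = (1 - z²) α_r'(z) / (1 - r²)`, the `r`-derivative of `‖p
∘ α_r‖²` pairs neighbouring coefficients with the factor `β_n² (n+1) - β_{n+1}² n`. The supremum
hypothesis makes this `O(β_n β_{n+1})`, and a Gronwall argument yields a power of `(1 + r) / (1 -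
r)`.

For a flow, each `φ_t` is injective, so the univalent estimate applies. It gives `‖T_t‖ ≤ e^{ωt}`
for small `t` once `|φ_t 0| = O(t)`, which is shown by averaging over time
(`exists_norm_apply_zero_le`). The semigroup law extends the bound to all `t`. Strong continuity
follows from convergence of coefficients together with the norm bound. -/

/-- The power series `A` converges on the unit disc with sum `F`. -/
def IsTaylor (A : PowerSeries ℂ) (F : ℂ → ℂ) : Prop :=
  ∀ z : ℂ, ‖z‖ < 1 → HasSum (fun n => PowerSeries.coeff n A * z ^ n) (F z)

namespace IsTaylor

variable {A B : PowerSeries ℂ} {F G : ℂ → ℂ}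

theorem add (hA : IsTaylor A F) (hB : IsTaylor B G) :
    IsTaylor (A + B) (fun z => F z + G z) := by
  intro z hz
  simpa [add_mul] using (hA z hz).add (hB z hz)

theorem const_mul (hA : IsTaylor A F) (c : ℂ) :
    IsTaylor (PowerSeries.C c * A) (fun z => c * F z) := by
  intro z hz
  simpa [mul_assoc] using (hA z hz).mul_left c

theorem sum {ι : Type*} (s : Finset ι) {A : ι → PowerSeries ℂ} {F : ι → ℂ → ℂ}
    (h : ∀ i ∈ s, IsTaylor (A i) (F i)) : IsTaylor (∑ i ∈ s, A i) (fun z => ∑ i ∈ s, F i z) := by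
  intro z hz
  simpa [Finset.sum_mul] using hasSum_sum fun i hi => h i hi z hz

theorem mul (hA : IsTaylor A F) (hB : IsTaylor B G) :
    IsTaylor (A * B) (fun z => F z * G z) := by
  intro z hz
  have h1 := (hA z hz).summable.norm
  have h2 := (hB z hz).summable.norm
  have h3 := (summable_norm_sum_mul_antidiagonal_of_summable_norm h1 h2).of_norm.hasSum
  rw [← tsum_mul_tsum_eq_tsum_sum_antidiagonal_of_summable_norm h1 h2, (hA z hz).tsum_eq,
    (hB z hz).tsum_eq] at h3
  refine h3.congr_fun fun n => ?_
  rw [PowerSeries.coeff_mul, Finset.sum_mul]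
  refine Finset.sum_congr rfl fun p hp => ?_
  rw [← Finset.HasAntidiagonal.mem_antidiagonal.1 hp, pow_add]
  ring

theorem one : IsTaylor 1 (fun _ => 1) := by
  intro z hz
  have := hasSum_single (f := fun n => PowerSeries.coeff n (1 : PowerSeries ℂ) * z ^ n) 0
    (fun n hn => by simp [PowerSeries.coeff_one, hn])
  simpa using this

theorem pow (hA : IsTaylor A F) (m : ℕ) : IsTaylor (A ^ m) (fun z => F z ^ m) := by
  induction m with
  | zero => simpa using one
  | succ m ih => simpa [pow_succ] using ih.mul hA

theorem hasFPowerSeriesOnBall (h : IsTaylor A F) :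
    HasFPowerSeriesOnBall F
      (FormalMultilinearSeries.ofScalars ℂ fun n => PowerSeries.coeff n A) 0 1 where
  r_le := by
    refine ENNReal.le_of_forall_nnreal_lt fun r hr => ?_
    refine FormalMultilinearSeries.le_radius_of_summable_norm _ ?_
    have hr' : ‖((r : ℝ) : ℂ)‖ < 1 := by simpa using hr
    refine (h _ hr').summable.norm.congr fun n => ?_
    simp
  r_pos := one_pos
  hasSum := by
    intro y hy
    have hy' : ‖y‖ < 1 := by
      rw [← ENNReal.ofReal_one, Metric.eball_ofReal] at hy
      simpa using hy
    simpa [FormalMultilinearSeries.ofScalars_apply_eq, mul_comm] using h y hy'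

theorem differentiableOn (h : IsTaylor A F) : DifferentiableOn ℂ F (Metric.ball 0 1) := by
  have := h.hasFPowerSeriesOnBall.differentiableOn
  rwa [← ENNReal.ofReal_one, Metric.eball_ofReal] at this

theorem of_differentiableOn (h : DifferentiableOn ℂ F (Metric.ball 0 1)) :
    IsTaylor (PowerSeries.mk fun n => iteratedDeriv n F 0 / n.factorial) F := by
  intro z hz
  refine (Complex.hasSum_taylorSeries_on_ball (c := 0) (r := 1) h
    (z := z) (by simpa using hz)).congr_fun fun n => ?_
  simp only [sub_zero, smul_eq_mul, PowerSeries.coeff_mk]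
  ring

theorem unique (hA : IsTaylor A F) (hB : IsTaylor B F) : A = B := by
  have := hA.hasFPowerSeriesOnBall.hasFPowerSeriesAt.eq_formalMultilinearSeries
    hB.hasFPowerSeriesOnBall.hasFPowerSeriesAt
  rw [FormalMultilinearSeries.ofScalars_series_eq_iff] at this
  ext n
  exact congrFun this n

theorem coeff_eq (h : IsTaylor A F) (n : ℕ) :
    PowerSeries.coeff n A = iteratedDeriv n F 0 / n.factorial := by
  rw [h.unique (of_differentiableOn h.differentiableOn), PowerSeries.coeff_mk]

theorem deriv (h : IsTaylor A F) : IsTaylor (PowerSeries.derivative ℂ A) (deriv F) := by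
  have := of_differentiableOn (h.differentiableOn.deriv Metric.isOpen_ball)
  convert! this using 1
  ext n
  rw [PowerSeries.coeff_derivative, PowerSeries.coeff_mk, h.coeff_eq, iteratedDeriv_succ',
    Nat.factorial_succ]
  have := Nat.factorial_ne_zero n
  push_cast
  field_simp

theorem apply_zero (h : IsTaylor A F) : PowerSeries.coeff 0 A = F 0 := by
  simp [h.coeff_eq]

/-- Cauchy's estimate for the coefficients. -/
theorem norm_coeff_le (h : IsTaylor A F) {ρ M : ℝ} (hρ : 0 < ρ) (hρ1 : ρ < 1)
    (hM : ∀ z, ‖z‖ = ρ → ‖F z‖ ≤ M) (n : ℕ) : ‖PowerSeries.coeff n A‖ ≤ M / ρ ^ n := by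
  have hd : DiffContOnCl ℂ F (Metric.ball 0 ρ) := by
    refine (h.differentiableOn.mono ?_).diffContOnCl
    rw [closure_ball _ hρ.ne']
    exact Metric.closedBall_subset_ball hρ1
  have := Complex.norm_iteratedDeriv_le_of_forall_mem_sphere_norm_le n hρ hd (C := M)
    (fun z hz => hM z (by simpa using hz))
  rw [h.coeff_eq, norm_div, Complex.norm_natCast, div_le_iff₀ (by positivity)]
  calc _ ≤ _ := this
    _ = _ := by ring

/-- Cauchy's estimate applied to the difference `F i - G`; one circle of convergence suffices. -/
theorem tendsto_coeff {ι : Type*} {l : Filter ι} {A : ι → PowerSeries ℂ} {F : ι → ℂ → ℂ}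
    {B : PowerSeries ℂ} {G : ℂ → ℂ} (hA : ∀ i, IsTaylor (A i) (F i)) (hB : IsTaylor B G)
    {ρ : ℝ} (hρ : 0 < ρ) (hρ1 : ρ < 1)
    (hlim : TendstoUniformlyOn F G l (Metric.sphere 0 ρ)) (n : ℕ) :
    Tendsto (fun i => PowerSeries.coeff n (A i)) l (𝓝 (PowerSeries.coeff n B)) := by
  rw [Metric.tendsto_nhds]
  intro ε hε
  have hε' : 0 < ε / 2 * ρ ^ n := by positivity
  filter_upwards [Metric.tendstoUniformlyOn_iff.1 hlim _ hε'] with i hi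
  have hsub : IsTaylor (A i + PowerSeries.C (-1) * B) (fun z => F i z + -1 * G z) :=
    (hA i).add (hB.const_mul (-1))
  have := hsub.norm_coeff_le hρ hρ1 (M := ε / 2 * ρ ^ n) (fun z hz => by
    have := hi z (by simpa using hz)
    rw [dist_comm, dist_eq_norm] at this
    simpa [sub_eq_add_neg] using this.le) n
  rw [mul_div_cancel_right₀ _ (by positivity)] at this
  rw [dist_eq_norm]
  refine lt_of_le_of_lt ?_ (half_lt_self hε)
  simpa [sub_eq_add_neg] using this

end IsTaylor

theorem IsHol.isTaylor {f : 𝔻 → ℂ} (hf : IsHol f) :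
    IsTaylor (PowerSeries.mk (taylorCoeff f)) (extendZero f) :=
  IsTaylor.of_differentiableOn hf

theorem IsTaylor.taylorCoeff_eq {A : PowerSeries ℂ} {f : 𝔻 → ℂ} (h : IsTaylor A (extendZero f))
    (n : ℕ) : taylorCoeff f n = PowerSeries.coeff n A :=
  (h.coeff_eq n).symm

theorem IsTaylor.isHol {A : PowerSeries ℂ} {f : 𝔻 → ℂ} (h : IsTaylor A (extendZero f)) :
    IsHol f :=
  h.differentiableOn

theorem extendZero_comp (f : 𝔻 → ℂ) (φ : 𝔻 → 𝔻) {z : ℂ} (hz : ‖z‖ < 1) :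
    extendZero (fun w => f (φ w)) z = extendZero f (extendZero (fun w => (φ w : ℂ)) z) := by
  simp [extendZero, hz, (φ (mk z hz)).norm_lt_one]

theorem norm_extendZero_lt_one (φ : 𝔻 → 𝔻) (z : ℂ) :
    ‖extendZero (fun w => (φ w : ℂ)) z‖ < 1 := by
  by_cases hz : ‖z‖ < 1
  · simp [extendZero, hz, (φ (mk z hz)).norm_lt_one]
  · simp [extendZero, hz]

theorem IsHol.comp {f : 𝔻 → ℂ} {φ : 𝔻 → 𝔻} (hf : IsHol f) (hφ : IsHol fun z => (φ z : ℂ)) :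
    IsHol fun z => f (φ z) := by
  have h : DifferentiableOn ℂ (extendZero f ∘ extendZero fun w => (φ w : ℂ)) (Metric.ball 0 1) :=
    DifferentiableOn.comp hf hφ fun z _ => by simpa using norm_extendZero_lt_one φ z
  exact h.congr fun z hz => extendZero_comp f φ (by simpa using hz)

/-- On a circle of radius less than one a holomorphic self-map of the disc stays away from the
unit circle. -/
theorem IsHol.exists_norm_le {φ : 𝔻 → 𝔻} (hφ : IsHol fun z => (φ z : ℂ)) {ρ : ℝ} (hρ1 : ρ < 1) :
    ∃ σ : ℝ, 0 ≤ σ ∧ σ < 1 ∧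
      ∀ z : ℂ, ‖z‖ ≤ ρ → ‖extendZero (fun w => (φ w : ℂ)) z‖ ≤ σ := by
  rcases lt_or_ge ρ 0 with h | h
  · exact ⟨0, le_rfl, one_pos, fun z hz => absurd (norm_nonneg z) (by linarith)⟩
  have hc : ContinuousOn (fun z => ‖extendZero (fun w => (φ w : ℂ)) z‖) (Metric.closedBall 0 ρ) :=
    (hφ.continuousOn.mono (Metric.closedBall_subset_ball hρ1)).norm
  obtain ⟨z, -, hz⟩ := (isCompact_closedBall (0 : ℂ) ρ).exists_isMaxOn
    ⟨0, by simpa using h⟩ hc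
  exact ⟨_, norm_nonneg _, norm_extendZero_lt_one φ z, fun w hw => hz (by simpa using hw)⟩

theorem IsTaylor.tendstoUniformlyOn {A : PowerSeries ℂ} {F : ℂ → ℂ} (h : IsTaylor A F) {σ : ℝ}
    (hσ0 : 0 ≤ σ) (hσ : σ < 1) :
    TendstoUniformlyOn (fun N z => ∑ m ∈ Finset.range N, PowerSeries.coeff m A * z ^ m) F atTop
      (Metric.closedBall 0 σ) := by
  have hs : Summable fun m => ‖PowerSeries.coeff m A * (σ : ℂ) ^ m‖ :=
    (h σ (by rwa [Complex.norm_real, Real.norm_of_nonneg hσ0])).summable.norm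
  have := tendstoUniformlyOn_tsum_nat hs (s := Metric.closedBall (0 : ℂ) σ)
    (f := fun m z => PowerSeries.coeff m A * z ^ m) (fun m z hz => by
      rw [norm_mul, norm_mul, norm_pow, norm_pow, Complex.norm_real, Real.norm_of_nonneg hσ0]
      gcongr
      simpa using hz)
  refine this.congr_right fun z hz => ?_
  exact (h z (lt_of_le_of_lt (by simpa using hz) hσ)).tsum_eq

/-- The Taylor coefficients of `f ∘ φ` are the limits of those of `p ∘ φ`, where `p` runs through
the Taylor polynomials of `f`. -/
theorem tendsto_coeff_comp {f : 𝔻 → ℂ} {φ : 𝔻 → 𝔻} {Φ : PowerSeries ℂ} (hf : IsHol f)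
    (hφ : IsTaylor Φ (extendZero fun z => (φ z : ℂ))) (n : ℕ) :
    Tendsto (fun N => PowerSeries.coeff n
      (∑ m ∈ Finset.range N, PowerSeries.C (taylorCoeff f m) * Φ ^ m)) atTop
      (𝓝 (taylorCoeff (fun z => f (φ z)) n)) := by
  have hcomp := (hf.comp hφ.isHol).isTaylor
  rw [hcomp.taylorCoeff_eq]
  refine IsTaylor.tendsto_coeff (ρ := 1 / 2) (fun N => IsTaylor.sum _ fun m _ =>
    (hφ.pow m).const_mul (taylorCoeff f m)) hcomp (by norm_num) (by norm_num) ?_ n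
  -- The image of the circle lies in a compact disc, where the Taylor polynomials of `f` converge
  -- uniformly.
  obtain ⟨σ, hσ0, hσ1, hσ⟩ := hφ.isHol.exists_norm_le (ρ := 1 / 2) (by norm_num)
  have h1 := (hf.isTaylor.tendstoUniformlyOn hσ0 hσ1).comp
    (extendZero fun z => (φ z : ℂ))
  have h2 := h1.mono (s' := Metric.sphere 0 (1 / 2)) (fun z hz => by
    simpa using hσ z (by simpa using (show ‖z‖ = 1 / 2 by simpa using hz).le))
  refine (h2.congr_right fun z hz => ?_).congr (Eventually.of_forall fun N z hz => ?_)
  · exact (extendZero_comp f φ (by rw [show ‖z‖ = 1 / 2 by simpa using hz]; norm_num)).symm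
  · simp

end WeightedHardy

/-! ### Circle means, area integrals and the Dirichlet integral -/

namespace WeightedHardy

open MeasureTheory

namespace IsTaylor

variable {A B : PowerSeries ℂ} {F G : ℂ → ℂ}

theorem continuousOn_sphere (h : IsTaylor A F) {r : ℝ} (hr1 : r < 1) :
    ContinuousOn F (Metric.sphere 0 r) :=
  h.differentiableOn.continuousOn.mono
    (Metric.sphere_subset_closedBall.trans (Metric.closedBall_subset_ball hr1))

/-- Splitting off the constant term of a power series. -/
theorem exists_shift (h : IsTaylor A F) :
    ∃ G, IsTaylor (PowerSeries.mk fun n => PowerSeries.coeff (n + 1) A) G ∧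
      ∀ z, ‖z‖ < 1 → F z = PowerSeries.coeff 0 A + z * G z := by
  refine ⟨fun z => ∑' n, PowerSeries.coeff (n + 1) A * z ^ n, ?_, ?_⟩
  · intro z hz
    simp only [PowerSeries.coeff_mk]
    refine Summable.hasSum ?_
    rcases eq_or_ne z 0 with rfl | hz0
    · exact summable_of_ne_finset_zero (s := {0}) fun n hn => by simp_all
    · refine (((summable_nat_add_iff 1).2 (h z hz).summable).mul_left z⁻¹).congr fun n => ?_
      rw [pow_succ]
      field_simp
  · intro z hz
    rw [← (h z hz).tsum_eq, (h z hz).summable.tsum_eq_zero_add, ← tsum_mul_left]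
    simp only [pow_zero, mul_one, add_right_inj]
    refine tsum_congr fun n => ?_
    ring

/-- Expand `|a + zG|²`: the cross term is the real part of a holomorphic function vanishing at `0`,
so its circle mean is zero. Iterating this peels off one coefficient at a time and yields both
Bessel and Parseval. -/
theorem circleAverage_sq_shift (hG : IsTaylor B G) (hFG : ∀ z, ‖z‖ < 1 → F z = PowerSeries.coeff 0 A + z * G z)
    {r : ℝ} (hr : 0 ≤ r) (hr1 : r < 1) :
    Real.circleAverage (fun z => ‖F z‖ ^ 2) 0 r =
      ‖PowerSeries.coeff 0 A‖ ^ 2 + r ^ 2 * Real.circleAverage (fun z => ‖G z‖ ^ 2) 0 r := by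
  set a := PowerSeries.coeff 0 A
  -- `L w = Re (2 ā w)` is the cross term; being real-linear, it commutes with the circle mean.
  let L : ℂ →L[ℝ] ℝ := Complex.reCLM ∘L
    (ContinuousLinearMap.mul ℝ ℂ (2 * (starRingEnd ℂ) a))
  have hd : DifferentiableOn ℂ (fun z => z * G z) (Metric.ball 0 1) :=
    differentiableOn_id.mul hG.differentiableOn
  have hc : ContinuousOn (fun z => z * G z) (Metric.sphere 0 |r|) := by
    rw [abs_of_nonneg hr]
    exact continuousOn_id.mul (hG.continuousOn_sphere hr1)
  have hmean : Real.circleAverage (fun z => z * G z) 0 r = 0 := by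
    have : DiffContOnCl ℂ (fun z => z * G z) (Metric.ball 0 |r|) := by
      refine (hd.mono (Metric.closure_ball_subset_closedBall.trans ?_)).diffContOnCl
      exact Metric.closedBall_subset_ball (by rwa [abs_of_nonneg hr])
    simpa using this.circleAverage
  have hL : Real.circleAverage (L ∘ fun z => z * G z) 0 r = 0 := by
    rw [L.circleAverage_comp_comm hc.circleIntegrable', hmean, map_zero]
  have hi1 : CircleIntegrable (L ∘ fun z => z * G z) 0 r :=
    (L.continuous.comp_continuousOn hc).circleIntegrable'
  have hi2 : CircleIntegrable (fun z => r ^ 2 * ‖G z‖ ^ 2) 0 r := by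
    refine ContinuousOn.circleIntegrable' ?_
    rw [abs_of_nonneg hr]
    exact continuousOn_const.mul ((hG.continuousOn_sphere hr1).norm.pow 2)
  have hi3 : CircleIntegrable (fun _ => ‖a‖ ^ 2) 0 r := continuousOn_const.circleIntegrable'
  have hrw : Real.circleAverage (fun z => ‖F z‖ ^ 2) 0 r = Real.circleAverage
      (fun z => (‖a‖ ^ 2 + r ^ 2 * ‖G z‖ ^ 2) + (L ∘ fun z => z * G z) z) 0 r := by
    refine Real.circleAverage_congr_sphere fun z hz => ?_
    have hz' : ‖z‖ = r := by simpa [abs_of_nonneg hr] using hz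
    have key : ∀ w : ℂ, ‖a + w‖ ^ 2 = ‖a‖ ^ 2 + ‖w‖ ^ 2 + (2 * (starRingEnd ℂ) a * w).re := by
      intro w
      rw [Complex.sq_norm, Complex.sq_norm, Complex.sq_norm]
      simp [Complex.normSq_apply]
      ring
    simp only [hFG z (by linarith), key, Function.comp_apply, norm_mul, hz', mul_pow]
    rfl
  rw [hrw, Real.circleAverage_fun_add (f₁ := fun z => ‖a‖ ^ 2 + r ^ 2 * ‖G z‖ ^ 2)
    (hi3.add hi2) hi1,
    Real.circleAverage_fun_add hi3 hi2, hL, Real.circleAverage_const, add_zero]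
  congr 1
  exact Real.circleAverage_fun_smul (a := r ^ 2) (f := fun z => ‖G z‖ ^ 2)

/-- Bessel's inequality on circles. -/
theorem sum_le_circleAverage (h : IsTaylor A F) {r : ℝ} (hr : 0 ≤ r) (hr1 : r < 1) (n : ℕ) :
    ∑ k ∈ Finset.range n, ‖PowerSeries.coeff k A‖ ^ 2 * r ^ (2 * k) ≤
      Real.circleAverage (fun z => ‖F z‖ ^ 2) 0 r := by
  induction n generalizing A F with
  | zero => simpa using Real.circleAverage_nonneg_of_nonneg fun z _ => by positivity
  | succ n ih =>
    obtain ⟨G, hG, hFG⟩ := h.exists_shift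
    rw [hG.circleAverage_sq_shift hFG hr hr1, Finset.sum_range_succ', add_comm]
    simp only [mul_zero, pow_zero, mul_one]
    gcongr
    refine le_trans (le_of_eq ?_) (mul_le_mul_of_nonneg_left (ih hG) (sq_nonneg r))
    rw [Finset.mul_sum]
    refine Finset.sum_congr rfl fun k _ => ?_
    rw [PowerSeries.coeff_mk]
    ring

/-- Parseval's identity on circles, for polynomials. -/
theorem circleAverage_eq_sum (h : IsTaylor A F) {r : ℝ} (hr : 0 ≤ r) (hr1 : r < 1) (n : ℕ)
    (hA : ∀ k, n ≤ k → PowerSeries.coeff k A = 0) :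
    Real.circleAverage (fun z => ‖F z‖ ^ 2) 0 r =
      ∑ k ∈ Finset.range n, ‖PowerSeries.coeff k A‖ ^ 2 * r ^ (2 * k) := by
  induction n generalizing A F with
  | zero =>
    have hF : ∀ z, ‖z‖ < 1 → F z = 0 := fun z hz => by
      rw [← (h z hz).tsum_eq]
      simp [hA]
    rw [Real.circleAverage_congr_sphere (f₂ := fun _ => 0), Real.circleAverage_const]
    · simp
    · intro z hz
      have hz' : ‖z‖ = r := by simpa [abs_of_nonneg hr] using hz
      simp [hF z (by linarith)]
  | succ n ih =>
    obtain ⟨G, hG, hFG⟩ := h.exists_shift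
    rw [hG.circleAverage_sq_shift hFG hr hr1, Finset.sum_range_succ', add_comm,
      ih hG fun k hk => by simpa using hA _ (by lia), Finset.mul_sum]
    simp only [mul_zero, pow_zero, mul_one, PowerSeries.coeff_mk]
    congr 1
    refine Finset.sum_congr rfl fun k _ => ?_
    ring

end IsTaylor

theorem lintegral_circle_eq {F : ℂ → ℝ} {r : ℝ} (hr : 0 ≤ r)
    (hF : ContinuousOn F (Metric.sphere 0 r)) (h0 : ∀ z, 0 ≤ F z) :
    ∫⁻ θ in Set.Ioo (-Real.pi) Real.pi,
      ENNReal.ofReal (F (r * (Real.cos θ + Real.sin θ * Complex.I))) =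
      ENNReal.ofReal (2 * Real.pi * Real.circleAverage F 0 r) := by
  have hmap : ∀ θ : ℝ, (r : ℂ) * (Real.cos θ + Real.sin θ * Complex.I) = circleMap 0 r θ := by
    intro θ
    rw [circleMap_zero, Complex.exp_mul_I, Complex.ofReal_cos, Complex.ofReal_sin]
  have hcont : Continuous fun θ => F (circleMap 0 r θ) := by
    rw [← continuousOn_univ]
    exact hF.comp (continuous_circleMap 0 r).continuousOn
      fun θ _ => circleMap_mem_sphere 0 hr θ
  simp_rw [hmap]
  rw [← ofReal_integral_eq_lintegral_ofReal
    ((hcont.integrableOn_Icc (a := -Real.pi) (b := Real.pi)).mono_set Set.Ioo_subset_Icc_self)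
    (ae_of_all _ fun θ => h0 _), ← integral_Ioc_eq_integral_Ioo,
    ← intervalIntegral.integral_of_le (by linarith [Real.pi_pos]),
    Real.circleAverage_eq_integral_add (-Real.pi),
    intervalIntegral.integral_comp_add_right (fun θ => F (circleMap 0 r θ))]
  congr 1
  rw [smul_eq_mul, mul_inv_cancel_left₀ (by positivity)]
  congr 1 <;> ring

/-- Polar coordinates. With values in `ℝ≥0∞`, no integrability up to the boundary has to be known.
-/
theorem lintegral_ball_eq {F : ℂ → ℝ} (hF : ContinuousOn F (Metric.ball 0 1))
    (h0 : ∀ z, 0 ≤ F z) :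
    ∫⁻ z in Metric.ball (0 : ℂ) 1, ENNReal.ofReal (F z) =
      ∫⁻ r in Set.Ioo (0 : ℝ) 1, ENNReal.ofReal (2 * Real.pi * r * Real.circleAverage F 0 r) := by
  set g : ℂ → ℝ≥0∞ := (Metric.ball (0 : ℂ) 1).indicator fun z => ENNReal.ofReal (F z) with hg
  have hgm : Measurable g := by
    classical
    have := (hF.measurable_piecewise (g := fun _ => 0) continuousOn_const
      Metric.isOpen_ball.measurableSet).ennreal_ofReal
    convert! this using 1
    funext z
    by_cases hz : z ∈ Metric.ball (0 : ℂ) 1 <;> simp [hg, Set.piecewise, hz]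
  rw [← lintegral_indicator Metric.isOpen_ball.measurableSet, ← hg,
    ← Complex.lintegral_comp_polarCoord_symm, show polarCoord.target = Set.Ioi (0 : ℝ) ×ˢ Set.Ioo (-Real.pi) Real.pi from rfl,
    Measure.volume_eq_prod,
    setLIntegral_prod]
  · have hsub : ∀ r : ℝ, 0 < r → ∫⁻ θ in Set.Ioo (-Real.pi) Real.pi,
        ENNReal.ofReal r • g (Complex.polarCoord.symm (r, θ)) =
        (Set.Ioo (0 : ℝ) 1).indicator
          (fun r => ENNReal.ofReal (2 * Real.pi * r * Real.circleAverage F 0 r)) r := by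
      intro r hr
      by_cases hr1 : r < 1
      · have hmem : ∀ θ, Complex.polarCoord.symm (r, θ) ∈ Metric.ball (0 : ℂ) 1 := fun θ => by
          rw [mem_ball_zero_iff, Complex.norm_polarCoord_symm, abs_of_pos hr]
          exact hr1
        have hval : ∀ θ, g (Complex.polarCoord.symm (r, θ)) =
            ENNReal.ofReal (F (r * (Real.cos θ + Real.sin θ * Complex.I))) := fun θ => by
          rw [hg, Set.indicator_of_mem (hmem θ), Complex.polarCoord_symm_apply]
        simp only [hval, smul_eq_mul,
          Set.indicator_of_mem (show r ∈ Set.Ioo (0 : ℝ) 1 from ⟨hr, hr1⟩)]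
        rw [lintegral_const_mul' _ _ ENNReal.ofReal_ne_top, lintegral_circle_eq hr.le
          (hF.mono (Metric.sphere_subset_closedBall.trans (Metric.closedBall_subset_ball hr1))) h0,
          ← ENNReal.ofReal_mul hr.le]
        congr 1
        ring
      · have hmem : ∀ θ, Complex.polarCoord.symm (r, θ) ∉ Metric.ball (0 : ℂ) 1 := fun θ => by
          rw [mem_ball_zero_iff, Complex.norm_polarCoord_symm, abs_of_pos hr]
          exact hr1
        simp only [hg, Set.indicator_of_notMem (hmem _), smul_zero, lintegral_zero,
          Set.indicator_of_notMem (show r ∉ Set.Ioo (0 : ℝ) 1 from fun h => hr1 h.2)]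
    rw [setLIntegral_congr_fun measurableSet_Ioi fun r hr => hsub r hr,
      setLIntegral_indicator measurableSet_Ioo]
    congr 2
    ext r
    simp only [Set.mem_inter_iff, Set.mem_Ioo, Set.mem_Ioi]
    tauto
  · refine Measurable.aemeasurable ?_
    refine Measurable.mul (ENNReal.measurable_ofReal.comp measurable_fst) (hgm.comp ?_)
    have : ⇑Complex.polarCoord.symm =
        fun p => (p.1 : ℂ) * (Real.cos p.2 + Real.sin p.2 * Complex.I) := by
      funext p
      simp
    rw [this]
    fun_prop

theorem lintegral_radial_eq (c : ℕ → ℝ) (hc : ∀ k, 0 ≤ c k) (n : ℕ) :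
    ∫⁻ r in Set.Ioo (0 : ℝ) 1,
      ENNReal.ofReal (2 * Real.pi * r * ∑ k ∈ Finset.range n, c k * r ^ (2 * k)) =
      ENNReal.ofReal (Real.pi * ∑ k ∈ Finset.range n, c k / (k + 1)) := by
  have hcont : Continuous fun r : ℝ =>
      2 * Real.pi * r * ∑ k ∈ Finset.range n, c k * r ^ (2 * k) := by fun_prop
  rw [← ofReal_integral_eq_lintegral_ofReal
    ((hcont.integrableOn_Icc (a := 0) (b := 1)).mono_set Set.Ioo_subset_Icc_self)
    ((ae_restrict_iff' measurableSet_Ioo).2 (ae_of_all _ fun r hr => ?_)),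
    ← integral_Ioc_eq_integral_Ioo, ← intervalIntegral.integral_of_le zero_le_one]
  · congr 1
    have : ∀ r : ℝ, 2 * Real.pi * r * ∑ k ∈ Finset.range n, c k * r ^ (2 * k) =
        ∑ k ∈ Finset.range n, 2 * Real.pi * c k * r ^ (2 * k + 1) := fun r => by
      rw [Finset.mul_sum]
      exact Finset.sum_congr rfl fun k _ => by ring
    simp_rw [this]
    rw [intervalIntegral.integral_finsetSum fun k _ => by
      exact Continuous.intervalIntegrable (by fun_prop) _ _, Finset.mul_sum]
    refine Finset.sum_congr rfl fun k _ => ?_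
    rw [intervalIntegral.integral_const_mul, integral_pow]
    push_cast
    field_simp
    simp
    ring
  · have : 0 ≤ ∑ k ∈ Finset.range n, c k * r ^ (2 * k) :=
      Finset.sum_nonneg fun k _ => mul_nonneg (hc k) (pow_nonneg hr.1.le _)
    have := hr.1.le
    positivity

/-- Bessel on each circle, integrated radially. For a fixed finite sum no limit has to be exchanged
with the integral. -/
theorem IsTaylor.ofReal_sum_le_lintegral {A : PowerSeries ℂ} {F : ℂ → ℂ} (h : IsTaylor A F)
    (n : ℕ) :
    ENNReal.ofReal (Real.pi * ∑ k ∈ Finset.range n, ‖PowerSeries.coeff k A‖ ^ 2 / (k + 1)) ≤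
      ∫⁻ z in Metric.ball (0 : ℂ) 1, ENNReal.ofReal (‖F z‖ ^ 2) := by
  rw [lintegral_ball_eq (F := fun z => ‖F z‖ ^ 2) (h.differentiableOn.continuousOn.norm.pow 2) fun z => by positivity,
    ← lintegral_radial_eq _ (fun k => by positivity)]
  refine setLIntegral_mono' measurableSet_Ioo fun r hr => ENNReal.ofReal_le_ofReal ?_
  have := hr.1
  gcongr
  exact h.sum_le_circleAverage hr.1.le hr.2 n

theorem IsTaylor.lintegral_eq_ofReal_sum {A : PowerSeries ℂ} {F : ℂ → ℂ} (h : IsTaylor A F)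
    (n : ℕ) (hA : ∀ k, n ≤ k → PowerSeries.coeff k A = 0) :
    ∫⁻ z in Metric.ball (0 : ℂ) 1, ENNReal.ofReal (‖F z‖ ^ 2) =
    ENNReal.ofReal (Real.pi * ∑ k ∈ Finset.range n, ‖PowerSeries.coeff k A‖ ^ 2 / (k + 1)) := by
  rw [lintegral_ball_eq (F := fun z => ‖F z‖ ^ 2) (h.differentiableOn.continuousOn.norm.pow 2) fun z => by positivity,
    ← lintegral_radial_eq _ (fun k => by positivity)]
  refine setLIntegral_congr_fun measurableSet_Ioo fun r hr => ?_
  simp only [h.circleAverage_eq_sum hr.1.le hr.2 n hA]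

/-- The change of variables formula for injective holomorphic functions. -/
theorem lintegral_image_eq_of_differentiableOn {φ : ℂ → ℂ}
    (hφ : DifferentiableOn ℂ φ (Metric.ball 0 1)) (hinj : Set.InjOn φ (Metric.ball 0 1))
    (g : ℂ → ℝ≥0∞) :
    ∫⁻ z in φ '' Metric.ball 0 1, g z =
      ∫⁻ z in Metric.ball (0 : ℂ) 1, ENNReal.ofReal (‖deriv φ z‖ ^ 2) * g (φ z) := by
  rw [lintegral_image_eq_lintegral_abs_det_fderiv_mul volume Metric.isOpen_ball.measurableSet
    (f' := fun z => ((ContinuousLinearMap.toSpanSingleton ℂ (deriv φ z)).restrictScalars ℝ))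
    (fun z hz => ((hφ.differentiableAt
      (Metric.isOpen_ball.mem_nhds hz)).hasDerivAt.hasFDerivAt.restrictScalars
        ℝ).hasFDerivWithinAt) hinj]
  refine setLIntegral_congr_fun Metric.isOpen_ball.measurableSet fun z _ => ?_
  -- The real Jacobian of multiplication by a complex number is its squared modulus.
  have : ((ContinuousLinearMap.toSpanSingleton ℂ (deriv φ z)).restrictScalars ℝ).det =
      ‖deriv φ z‖ ^ 2 := by
    simp [ContinuousLinearMap.det, LinearMap.det_restrictScalars, Algebra.norm_complex_eq,
      Complex.normSq_eq_norm_sq]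
  simp only [this, abs_of_nonneg (sq_nonneg ‖deriv φ z‖)]

theorem coeff_sum_C_mul_X_pow (a : ℕ → ℂ) (n k : ℕ) :
    PowerSeries.coeff k (∑ m ∈ Finset.range n, PowerSeries.C (a m) * PowerSeries.X ^ m) =
      if k < n then a k else 0 := by
  simp [PowerSeries.coeff_X_pow]

theorem IsTaylor.X : IsTaylor PowerSeries.X (fun z => z) := by
  intro z hz
  have := hasSum_single (f := fun n => PowerSeries.coeff n (PowerSeries.X : PowerSeries ℂ) * z ^ n)
    1 (fun n hn => by simp [PowerSeries.coeff_X, hn])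
  simpa using this

/-- Composition of a polynomial with a univalent self-map of the disc does not increase the
Dirichlet integral. -/
theorem IsUnivalent.sum_coeff_le {φ : 𝔻 → 𝔻} (hφ : IsUnivalent φ) {Φ : PowerSeries ℂ}
    (hΦ : IsTaylor Φ (extendZero fun z => (φ z : ℂ))) (a : ℕ → ℂ) (n : ℕ) :
    ∑ k ∈ Finset.range n, ((k : ℝ) + 1) * ‖PowerSeries.coeff (k + 1)
      (∑ m ∈ Finset.range (n + 1), PowerSeries.C (a m) * Φ ^ m)‖ ^ 2 ≤
      ∑ k ∈ Finset.range n, ((k : ℝ) + 1) * ‖a (k + 1)‖ ^ 2 := by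
  set F := extendZero fun z => (φ z : ℂ) with hF
  have hball : ∀ z, F z ∈ Metric.ball (0 : ℂ) 1 := fun z => by
    simpa using norm_extendZero_lt_one φ z
  have hinj : Set.InjOn F (Metric.ball 0 1) := by
    intro z hz w hw hzw
    rw [mem_ball_zero_iff] at hz hw
    have : φ (mk z hz) = φ (mk w hw) := by
      apply Complex.UnitDisc.coe_injective
      simpa [hF, extendZero, hz, hw] using hzw
    simpa using hφ.2 this
  set p : ℂ → ℂ := fun w => ∑ m ∈ Finset.range (n + 1), a m * w ^ m with hp
  have hpA : IsTaylor _ p := IsTaylor.sum (Finset.range (n + 1)) fun m _ =>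
    (IsTaylor.X.pow m).const_mul (a m)
  have hG : IsTaylor _ (fun z => p (F z)) := IsTaylor.sum (Finset.range (n + 1)) fun m _ =>
    (hΦ.pow m).const_mul (a m)
  -- For `p ∘ φ` only the lower bound by Bessel is needed; for the polynomial `p` the area integral
  -- is computed exactly, and its degree matches the length of the sum.
  have h1 := hG.deriv.ofReal_sum_le_lintegral n
  have h2 := hpA.deriv.lintegral_eq_ofReal_sum n fun k hk => by
    rw [PowerSeries.coeff_derivative, coeff_sum_C_mul_X_pow, if_neg (by lia), zero_mul]
  have hderiv : ∀ z ∈ Metric.ball (0 : ℂ) 1,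
      deriv (fun z => p (F z)) z = deriv p (F z) * deriv F z := fun z hz =>
    deriv_comp z (hpA.differentiableOn.differentiableAt (Metric.isOpen_ball.mem_nhds (hball z)))
      (hΦ.differentiableOn.differentiableAt (Metric.isOpen_ball.mem_nhds hz))
  have h3 : ∫⁻ z in Metric.ball (0 : ℂ) 1, ENNReal.ofReal (‖deriv (fun z => p (F z)) z‖ ^ 2) ≤
      ∫⁻ z in Metric.ball (0 : ℂ) 1, ENNReal.ofReal (‖deriv p z‖ ^ 2) := by
    calc _ = ∫⁻ z in Metric.ball (0 : ℂ) 1, ENNReal.ofReal (‖deriv F z‖ ^ 2) *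
          ENNReal.ofReal (‖deriv p (F z)‖ ^ 2) := by
          refine setLIntegral_congr_fun Metric.isOpen_ball.measurableSet fun z hz => ?_
          simp only [hderiv z hz]
          rw [← ENNReal.ofReal_mul (by positivity), norm_mul]
          congr 1
          ring
      _ = ∫⁻ z in F '' Metric.ball 0 1, ENNReal.ofReal (‖deriv p z‖ ^ 2) :=
          (lintegral_image_eq_of_differentiableOn hΦ.differentiableOn hinj
            fun w => ENNReal.ofReal (‖deriv p w‖ ^ 2)).symm
      _ ≤ _ := lintegral_mono_set (by rintro _ ⟨z, -, rfl⟩; exact hball z)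
  have h4 := (ENNReal.ofReal_le_ofReal_iff (by positivity)).1 ((h1.trans h3).trans h2.le)
  have h5 := le_of_mul_le_mul_left h4 Real.pi_pos
  have hterm : ∀ (x : ℂ) (k : ℕ), ‖x * ((k : ℂ) + 1)‖ ^ 2 / ((k : ℝ) + 1) =
      ((k : ℝ) + 1) * ‖x‖ ^ 2 := by
    intro x k
    have hk : ‖(k : ℂ) + 1‖ = (k : ℝ) + 1 := by
      exact_mod_cast Complex.norm_natCast (k + 1)
    rw [norm_mul, hk]
    field_simp
  simp only [PowerSeries.coeff_derivative, hterm] at h5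
  refine h5.trans (le_of_eq (Finset.sum_congr rfl fun k hk => ?_))
  rw [coeff_sum_C_mul_X_pow, if_pos (by have := Finset.mem_range.1 hk; lia)]

/-- If `φ 0 = 0`, the first coefficients of `f ∘ φ` depend only on those of `f`. -/
theorem taylorCoeff_comp_eq {f : 𝔻 → ℂ} {φ : 𝔻 → 𝔻} {Φ : PowerSeries ℂ} (hf : IsHol f)
    (hΦ : IsTaylor Φ (extendZero fun z => (φ z : ℂ))) (h0 : φ 0 = 0) {n k : ℕ} (hkn : k < n) :
    taylorCoeff (fun z => f (φ z)) k = PowerSeries.coeff k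
      (∑ m ∈ Finset.range n, PowerSeries.C (taylorCoeff f m) * Φ ^ m) := by
  -- As `φ 0 = 0`, `Φ ^ m` starts in degree at least `m`, so adding terms with `m > k` does not
  -- change the `k`-th coefficient.
  have hX : PowerSeries.X ∣ Φ := by
    rw [PowerSeries.X_dvd_iff, ← PowerSeries.coeff_zero_eq_constantCoeff_apply, hΦ.apply_zero]
    have := extendZero_coe (fun z => (φ z : ℂ)) 0
    rw [Complex.UnitDisc.coe_zero] at this
    simp [this, h0]
  have hzero : ∀ m, k < m → PowerSeries.coeff k (Φ ^ m) = 0 := fun m hm =>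
    PowerSeries.X_pow_dvd_iff.1 (pow_dvd_pow_of_dvd hX m) k hm
  refine tendsto_nhds_unique (tendsto_coeff_comp hf hΦ k)
    (tendsto_const_nhds.congr' ?_)
  filter_upwards [eventually_ge_atTop n] with N hN
  rw [map_sum, map_sum]
  refine Finset.sum_subset (Finset.range_mono hN) fun m _ hm => ?_
  rw [PowerSeries.coeff_C_mul, hzero m (by rw [Finset.mem_range] at hm; lia), mul_zero]

/-- Abel summation, by induction on the sharper claim that the weighted gap is at least `w n` times
the unweighted gap. -/
theorem sum_mul_le_of_antitone {w x y : ℕ → ℝ} (hw : ∀ n, 0 ≤ w n) (hanti : Antitone w)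
    (h : ∀ n, ∑ k ∈ Finset.range n, x k ≤ ∑ k ∈ Finset.range n, y k) (n : ℕ) :
    ∑ k ∈ Finset.range n, w k * x k ≤ ∑ k ∈ Finset.range n, w k * y k := by
  have key : ∀ n, w n * (∑ k ∈ Finset.range n, y k - ∑ k ∈ Finset.range n, x k) ≤
      ∑ k ∈ Finset.range n, w k * y k - ∑ k ∈ Finset.range n, w k * x k := by
    intro n
    induction n with
    | zero => simp
    | succ n ih =>
      refine (mul_le_mul_of_nonneg_right (hanti n.le_succ) (sub_nonneg.2 (h (n + 1)))).trans ?_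
      simp only [Finset.sum_range_succ]
      linarith
  have := mul_nonneg (hw n) (sub_nonneg.2 (h n))
  linarith [key n]

end WeightedHardy

/-! ### Univalent maps: contractions at the origin and reduction to `α_r` -/

namespace WeightedHardy

namespace H2

variable {β : Weight}

theorem hasSum_norm_sq (f : H2 β) :
    HasSum (fun n => ‖taylorCoeff f n‖ ^ 2 * (β n : ℝ) ^ 2) (‖f‖ ^ 2) := by
  rw [norm_eq, Real.sq_sqrt (tsum_nonneg fun n => by positivity)]
  exact f.2.2.hasSum

theorem sum_le_norm_sq (f : H2 β) (s : Finset ℕ) :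
    ∑ n ∈ s, ‖taylorCoeff f n‖ ^ 2 * (β n : ℝ) ^ 2 ≤ ‖f‖ ^ 2 :=
  sum_le_hasSum s (fun n _ => by positivity) f.hasSum_norm_sq

end H2

variable {β : Weight}

/-- A composition operator is bounded as soon as its norm estimate holds for partial sums. -/
theorem exists_isCompositionOperator {φ : 𝔻 → 𝔻} (hφ : IsHol fun z => (φ z : ℂ)) {K : ℝ}
    (hK : 0 ≤ K) (h : ∀ (f : H2 β) (N : ℕ),
      ∑ n ∈ Finset.range N, ‖taylorCoeff (fun z => f (φ z)) n‖ ^ 2 * (β n : ℝ) ^ 2 ≤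
        K ^ 2 * ‖f‖ ^ 2) :
    ∃ C : H2 β →L[ℂ] H2 β, IsCompositionOperator C φ ∧ ‖C‖ ≤ K := by
  have hmem : ∀ f : H2 β, (fun z => f (φ z)) ∈ submodule β := fun f =>
    ⟨f.2.1.comp hφ, summable_of_sum_range_le (fun n => by positivity) (h f)⟩
  let L : H2 β →ₗ[ℂ] H2 β :=
    { toFun := fun f => (⟨fun z => f (φ z), hmem f⟩ : submodule β)
      map_add' := fun f g => rfl
      map_smul' := fun c f => rfl }
  have hL : ∀ f, ‖L f‖ ≤ K * ‖f‖ := fun f => by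
    rw [← abs_of_nonneg (norm_nonneg (L f)), ← abs_of_nonneg (mul_nonneg hK (norm_nonneg f)),
      ← sq_le_sq, mul_pow]
    exact le_of_tendsto' (L f).hasSum_norm_sq.tendsto_sum_nat (h f)
  exact ⟨L.mkContinuous K hL, fun f z => rfl, L.mkContinuous_norm_le hK hL⟩

theorem IsCompositionOperator.comp {C D : H2 β →L[ℂ] H2 β} {φ ψ : 𝔻 → 𝔻}
    (hC : IsCompositionOperator C φ) (hD : IsCompositionOperator D ψ) :
    IsCompositionOperator (D.comp C) (fun z => φ (ψ z)) := fun f z => by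
  rw [ContinuousLinearMap.comp_apply, hD, hC]

/-- Univalent self-maps of the disc that fix the origin induce contractions. -/
theorem IsUnivalent.exists_contraction
    (hmono : ∀ m n : ℕ, 1 ≤ m → m ≤ n →
      (β n : ℝ) / Real.sqrt n ≤ (β m : ℝ) / Real.sqrt m)
    {φ : 𝔻 → 𝔻} (hφ : IsUnivalent φ) (h0 : φ 0 = 0) :
    ∃ C : H2 β →L[ℂ] H2 β, IsCompositionOperator C φ ∧ ‖C‖ ≤ 1 := by
  refine exists_isCompositionOperator hφ.1 zero_le_one fun f N => ?_
  rw [one_pow, one_mul]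
  have hle : ∀ n, ∑ k ∈ Finset.range n, ((k : ℝ) + 1) *
        ‖taylorCoeff (fun z => f (φ z)) (k + 1)‖ ^ 2 ≤
      ∑ k ∈ Finset.range n, ((k : ℝ) + 1) * ‖taylorCoeff f (k + 1)‖ ^ 2 := fun n => by
    refine le_trans (le_of_eq (Finset.sum_congr rfl fun k hk => ?_))
      (hφ.sum_coeff_le hφ.1.isTaylor (taylorCoeff f) n)
    rw [taylorCoeff_comp_eq f.2.1 hφ.1.isTaylor h0 (n := n + 1)
      (by have := Finset.mem_range.1 hk; lia)]
  -- These are the squares of `β_k / √k`, shifted by one, so that `w k` times the Dirichlet weight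
  -- `k + 1` is `β_{k+1}²`.
  set w : ℕ → ℝ := fun k => (β (k + 1) : ℝ) ^ 2 / ((k : ℝ) + 1) with hw
  have hanti : Antitone w := fun m n hmn => by
    have := pow_le_pow_left₀ (by have := (β (n + 1)).2.le; positivity)
      (hmono (m + 1) (n + 1) (by lia) (by lia)) 2
    rw [div_pow, div_pow, Real.sq_sqrt (by positivity), Real.sq_sqrt (by positivity)] at this
    simp only [hw]
    exact_mod_cast this
  have hsum := sum_mul_le_of_antitone (fun n => by positivity) hanti hle
  have hzero : taylorCoeff (fun z => f (φ z)) 0 = taylorCoeff f 0 := by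
    have h1 := (f.2.1.comp hφ.1).isTaylor.apply_zero
    have h2 := f.2.1.isTaylor.apply_zero
    rw [PowerSeries.coeff_mk, ← Complex.UnitDisc.coe_zero, extendZero_coe] at h1 h2
    rw [h1, h2, h0]
  have hterm : ∀ (x : ℂ) (k : ℕ),
      w k * (((k : ℝ) + 1) * ‖x‖ ^ 2) = ‖x‖ ^ 2 * (β (k + 1) : ℝ) ^ 2 := fun x k => by
    rw [hw]
    field_simp
  simp only [hterm] at hsum
  refine le_trans ?_ (f.sum_le_norm_sq (Finset.range (N + 1)))
  refine le_trans (Finset.sum_le_sum_of_subset_of_nonneg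
    (Finset.range_mono N.le_succ) fun _ _ _ => by positivity) ?_
  rw [Finset.sum_range_succ', Finset.sum_range_succ' _ N, hzero]
  exact add_le_add_left (hsum N) _

theorem norm_mobius_inv_lt_one {r : ℝ} (hr : r ∈ Set.Ioo (0 : ℝ) 1) (z : 𝔻) :
    ‖((z : ℂ) - r) / (1 - r * z)‖ < 1 := by
  have h := norm_mobius_lt_one hr (-z)
  rw [Complex.UnitDisc.coe_neg] at h
  rw [← norm_neg]
  convert! h using 2
  ring

/-- The inverse of `mobius r hr`. -/
noncomputable def mobiusInv (r : ℝ) (hr : r ∈ Set.Ioo (0 : ℝ) 1) (z : 𝔻) : 𝔻 :=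
  Complex.UnitDisc.mk (((z : ℂ) - r) / (1 - r * z)) (norm_mobius_inv_lt_one hr z)

theorem one_add_mul_ne_zero {r : ℝ} (hr : r ∈ Set.Ioo (0 : ℝ) 1) {z : ℂ} (hz : ‖z‖ < 1) :
    1 + r * z ≠ 0 := by
  intro h
  have h1 : ‖(r : ℂ) * z‖ = 1 := by rw [eq_neg_of_add_eq_zero_right h]; simp
  rw [norm_mul, Complex.norm_real, Real.norm_of_nonneg hr.1.le] at h1
  nlinarith [hr.1, hr.2, norm_nonneg z]

theorem one_sub_mul_ne_zero {r : ℝ} (hr : r ∈ Set.Ioo (0 : ℝ) 1) {z : ℂ} (hz : ‖z‖ < 1) :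
    1 - r * z ≠ 0 := by
  simpa [sub_eq_add_neg] using one_add_mul_ne_zero hr (z := -z) (by simpa using hz)

theorem mobius_mobiusInv {r : ℝ} (hr : r ∈ Set.Ioo (0 : ℝ) 1) (z : 𝔻) :
    mobius r hr (mobiusInv r hr z) = z := by
  apply Complex.UnitDisc.coe_injective
  have h1 := one_sub_mul_ne_zero hr z.norm_lt_one
  have h2 := one_add_mul_ne_zero hr (mobiusInv r hr z).norm_lt_one
  simp only [mobius, mobiusInv, Complex.UnitDisc.coe_mk] at *
  rw [div_eq_iff h2]
  linear_combination div_mul_cancel₀ ((z : ℂ) - r) h1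

theorem isHol_mobiusInv {r : ℝ} (hr : r ∈ Set.Ioo (0 : ℝ) 1) :
    IsHol fun z => (mobiusInv r hr z : ℂ) := by
  have h : DifferentiableOn ℂ (fun z : ℂ => (z - r) / (1 - r * z)) (Metric.ball 0 1) := by
    refine DifferentiableOn.div (by fun_prop) (by fun_prop) fun z hz => ?_
    exact one_sub_mul_ne_zero hr (by simpa using hz)
  refine h.congr fun z hz => ?_
  have hz' : ‖z‖ < 1 := by simpa using hz
  simp [extendZero, hz', mobiusInv]

theorem IsHol.const_mul {φ : 𝔻 → ℂ} (hφ : IsHol φ) (c : ℂ) : IsHol fun z => c * φ z :=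
  hφ.smul c

theorem isUnivalent_rotation (u : Circle) : IsUnivalent (fun z => u • z) := by
  refine ⟨?_, MulAction.injective u⟩
  have h : IsHol fun z : 𝔻 => (z : ℂ) := by
    refine differentiableOn_id.congr fun z hz => ?_
    have hz' : ‖z‖ < 1 := by simpa using hz
    simp [extendZero, hz']
  exact h.const_mul u

/-- A norm estimate for the disc automorphisms `mobius r` extends to all univalent maps. -/
theorem IsUnivalent.hasCompositionBound
    (hmono : ∀ m n : ℕ, 1 ≤ m → m ≤ n →
      (β n : ℝ) / Real.sqrt n ≤ (β m : ℝ) / Real.sqrt m)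
    {a : ℝ} (hM : MobiusEstimate β a) {φ : 𝔻 → 𝔻} (hφ : IsUnivalent φ) :
    HasCompositionBound β a φ := by
  rcases eq_or_ne (φ 0) 0 with h0 | h0
  · obtain ⟨C, hC, hC1⟩ := hφ.exists_contraction hmono h0
    exact ⟨C, hC, by simpa [h0] using hC1⟩
  set r : ℝ := ‖(φ 0 : ℂ)‖ with hr
  have hr0 : r ≠ 0 := by simpa [hr] using h0
  have hrI : r ∈ Set.Ioo (0 : ℝ) 1 :=
    ⟨lt_of_le_of_ne (norm_nonneg _) hr0.symm, (φ 0).norm_lt_one⟩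
  -- `u` is the argument of `φ 0`, so `u⁻¹ • φ` sends `0` to `r`, and `mobiusInv` moves it back to
  -- the origin.
  let u : Circle := ⟨(φ 0 : ℂ) / r, mem_sphere_zero_iff_norm.2 (by
    rw [norm_div, Complex.norm_real, Real.norm_of_nonneg hrI.1.le, div_self hr0])⟩
  set ψ : 𝔻 → 𝔻 := fun z => mobiusInv r hrI (u⁻¹ • φ z) with hψ
  have hφψ : φ = fun z => u • mobius r hrI (ψ z) := by
    funext z
    rw [hψ, mobius_mobiusInv, smul_inv_smul]
  have hψU : IsUnivalent ψ := by
    refine ⟨(isHol_mobiusInv hrI).comp (φ := fun z => u⁻¹ • φ z) (hφ.1.const_mul _), ?_⟩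
    intro z w hzw
    refine hφ.2 ?_
    rw [hφψ]
    simp only [hzw]
  have hψ0 : ψ 0 = 0 := by
    have : ((u⁻¹ • φ 0 : 𝔻) : ℂ) = r := by
      rw [Complex.UnitDisc.coe_circle_smul, Circle.coe_inv]
      change ((φ 0 : ℂ) / r)⁻¹ * φ 0 = r
      have : (φ 0 : ℂ) ≠ 0 := by simpa using h0
      field_simp
    apply Complex.UnitDisc.coe_injective
    simp only [hψ, mobiusInv, Complex.UnitDisc.coe_mk, this, sub_self, zero_div,
      Complex.UnitDisc.coe_zero]
  -- The rotation is itself univalent and fixes `0`, hence it costs nothing.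
  obtain ⟨C₁, hC₁, hn₁⟩ := (isUnivalent_rotation u).exists_contraction hmono
    (Complex.UnitDisc.coe_injective (by simp))
  obtain ⟨C₂, hC₂, hn₂⟩ := hM r hrI
  obtain ⟨C₃, hC₃, hn₃⟩ := hψU.exists_contraction hmono hψ0
  refine ⟨C₃.comp (C₂.comp C₁), ?_, ?_⟩
  · rw [hφψ]
    exact (hC₁.comp hC₂).comp hC₃
  · calc ‖C₃.comp (C₂.comp C₁)‖ ≤ ‖C₃‖ * (‖C₂‖ * ‖C₁‖) :=
          (C₃.opNorm_comp_le _).trans (by gcongr; exact C₂.opNorm_comp_le _)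
      _ ≤ 1 * (‖C₂‖ * 1) := by gcongr
      _ ≤ _ := by simpa using hn₂

end WeightedHardy

/-! ### The family `α_r`: Taylor coefficients and their dependence on `r` -/

namespace WeightedHardy

/-- The Taylor series of `z ↦ (z + r) / (1 + r z)`. -/
noncomputable def mobiusSeries (r : ℝ) : PowerSeries ℂ :=
  PowerSeries.mk fun n => if n = 0 then (r : ℂ) else (1 - r ^ 2) * (-r) ^ (n - 1)

theorem isTaylor_mobius {r : ℝ} (hr : r ∈ Set.Ioo (0 : ℝ) 1) :
    IsTaylor (mobiusSeries r) (extendZero fun z => (mobius r hr z : ℂ)) := by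
  intro z hz
  have hne := one_add_mul_ne_zero hr hz
  have hlt : ‖-(r : ℂ) * z‖ < 1 := by
    rw [norm_mul, norm_neg, Complex.norm_real, Real.norm_of_nonneg hr.1.le]
    nlinarith [hr.1, hr.2, norm_nonneg z]
  have h := (hasSum_geometric_of_norm_lt_one hlt).mul_left ((1 - (r : ℂ) ^ 2) * z)
  have hval : extendZero (fun z => (mobius r hr z : ℂ)) z = (z + r) / (1 + r * z) := by
    simp [extendZero, hz, mobius]
  rw [hval, ← hasSum_nat_add_iff' 1]
  convert! h using 1
  · funext n
    simp [mobiusSeries]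
    ring
  · have : 1 - -(r : ℂ) * z = 1 + r * z := by ring
    rw [this, ← div_eq_mul_inv, eq_div_iff hne]
    simp [mobiusSeries, -PowerSeries.coeff_zero_eq_constantCoeff]
    rw [sub_mul, div_mul_cancel₀ _ hne]
    ring

theorem mobiusSeries_zero : mobiusSeries 0 = PowerSeries.X := by
  ext n
  rcases n with _ | _ | n <;> simp [mobiusSeries, PowerSeries.coeff_X]

/-- The derivation `(1 - X²) d/dX`. -/
noncomputable def hypDeriv (A : PowerSeries ℂ) : PowerSeries ℂ :=
  (1 - PowerSeries.X ^ 2) * PowerSeries.derivative ℂ A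

theorem hypDeriv_mul (A B : PowerSeries ℂ) :
    hypDeriv (A * B) = hypDeriv A * B + A * hypDeriv B := by
  simp only [hypDeriv, Derivation.leibniz, smul_eq_mul]
  ring

theorem coeff_zero_hypDeriv (A : PowerSeries ℂ) :
    PowerSeries.coeff 0 (hypDeriv A) = PowerSeries.coeff 1 A := by
  rw [hypDeriv, sub_mul, one_mul, map_sub, PowerSeries.coeff_X_pow_mul', if_neg (by norm_num),
    PowerSeries.coeff_derivative]
  simp

theorem coeff_succ_hypDeriv (A : PowerSeries ℂ) (n : ℕ) :
    PowerSeries.coeff (n + 1) (hypDeriv A) =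
      (n + 2) * PowerSeries.coeff (n + 2) A - n * PowerSeries.coeff n A := by
  rw [hypDeriv, sub_mul, one_mul, map_sub, PowerSeries.coeff_X_pow_mul',
    PowerSeries.coeff_derivative]
  rcases n with _ | n
  · simp
    ring
  · rw [if_pos (by lia), PowerSeries.coeff_derivative]
    simp
    ring

/-- Coefficientwise form of `(1 - r²) ∂α_r/∂r = (1 - z²) α_r'(z)`: up to reparametrisation, `α_r` is
the flow of the field `1 - z²`. -/
theorem hasDerivAt_coeff_mobiusSeries {r : ℝ} (hr : 1 - (r : ℂ) ^ 2 ≠ 0) (n : ℕ) :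
    HasDerivAt (fun r : ℝ => PowerSeries.coeff n (mobiusSeries r))
      (PowerSeries.coeff n (hypDeriv (mobiusSeries r)) / (1 - (r : ℂ) ^ 2)) r := by
  have hid : HasDerivAt (fun r : ℝ => (r : ℂ)) 1 r := Complex.ofRealCLM.hasDerivAt
  have hsq : HasDerivAt (fun r : ℝ => (1 : ℂ) - (r : ℂ) ^ 2) (-(2 * (r : ℂ))) r := by
    simpa using (hid.pow 2).const_sub 1
  rcases n with _ | n
  · rw [coeff_zero_hypDeriv]
    simpa [mobiusSeries, hr] using hid
  · rw [coeff_succ_hypDeriv]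
    have h := hsq.mul (hid.neg.pow n)
    simp only [mobiusSeries, PowerSeries.coeff_mk, Nat.add_eq_zero_iff, one_ne_zero, and_false,
      if_false, Nat.add_sub_cancel, OfNat.ofNat_ne_zero]
    convert! h using 1
    rw [div_eq_iff hr]
    rcases n with _ | n
    · simp
      ring
    · simp
      ring

/-- Both sides obey the product rule, so the identity passes from `α_r` to its powers. -/
theorem hasDerivAt_coeff_mobiusSeries_pow {r : ℝ} (hr : 1 - (r : ℂ) ^ 2 ≠ 0) (m n : ℕ) :
    HasDerivAt (fun r : ℝ => PowerSeries.coeff n (mobiusSeries r ^ m))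
      (PowerSeries.coeff n (hypDeriv (mobiusSeries r ^ m)) / (1 - (r : ℂ) ^ 2)) r := by
  induction m generalizing n with
  | zero => simpa [hypDeriv] using hasDerivAt_const r _
  | succ m ih =>
    simp only [pow_succ, hypDeriv_mul, PowerSeries.coeff_mul, map_add]
    rw [← Finset.sum_add_distrib, Finset.sum_div]
    refine HasDerivAt.fun_sum fun p _ => ?_
    refine ((ih p.1).mul (hasDerivAt_coeff_mobiusSeries hr p.2)).congr_deriv ?_
    field_simp

/-- The Taylor series of `p ∘ mobius r` for the polynomial `p = ∑_{m < M} a_m X^m`. -/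
noncomputable def mobiusPoly (a : ℕ → ℂ) (M : ℕ) (r : ℝ) : PowerSeries ℂ :=
  ∑ m ∈ Finset.range M, PowerSeries.C (a m) * mobiusSeries r ^ m

theorem hasDerivAt_coeff_mobiusPoly (a : ℕ → ℂ) (M : ℕ) {r : ℝ} (hr : 1 - (r : ℂ) ^ 2 ≠ 0)
    (n : ℕ) :
    HasDerivAt (fun r : ℝ => PowerSeries.coeff n (mobiusPoly a M r))
      (PowerSeries.coeff n (hypDeriv (mobiusPoly a M r)) / (1 - (r : ℂ) ^ 2)) r := by
  have hlin : hypDeriv (mobiusPoly a M r) =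
      ∑ m ∈ Finset.range M, PowerSeries.C (a m) * hypDeriv (mobiusSeries r ^ m) := by
    simp only [hypDeriv, mobiusPoly, map_sum, Finset.mul_sum]
    refine Finset.sum_congr rfl fun m _ => ?_
    rw [← PowerSeries.smul_eq_C_mul, ← PowerSeries.smul_eq_C_mul, Derivation.map_smul,
      mul_smul_comm]
  rw [hlin]
  simp only [mobiusPoly, map_sum, PowerSeries.coeff_C_mul, Finset.sum_div, mul_div_assoc]
  exact HasDerivAt.fun_sum fun m _ =>
    (hasDerivAt_coeff_mobiusSeries_pow hr m n).const_mul (a m)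

/-- The factor `q⁻¹` absorbs the exponent `n - 1`. Uniformity in `r ≤ q` is what later makes the
boundary term of the energy estimate negligible. -/
theorem norm_coeff_mobiusSeries_le {q r : ℝ} (hq : 0 < q) (hq1 : q < 1) (hr : 0 ≤ r)
    (hrq : r ≤ q) (n : ℕ) : ‖PowerSeries.coeff n (mobiusSeries r)‖ ≤ q⁻¹ * q ^ n := by
  rcases n with _ | n
  · have : 1 ≤ q⁻¹ := (one_le_inv₀ hq).2 hq1.le
    simp [mobiusSeries, abs_of_nonneg hr]
    linarith
  · have h1 : ‖(1 : ℂ) - (r : ℂ) ^ 2‖ ≤ 1 := by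
      have : (1 : ℂ) - (r : ℂ) ^ 2 = ((1 - r ^ 2 : ℝ) : ℂ) := by push_cast; rfl
      rw [this, Complex.norm_real, Real.norm_of_nonneg (by nlinarith)]
      nlinarith
    simp only [mobiusSeries, PowerSeries.coeff_mk, Nat.add_eq_zero_iff, one_ne_zero, and_false,
      if_false, Nat.add_sub_cancel, norm_mul, norm_pow, norm_neg, Complex.norm_real,
      Real.norm_of_nonneg hr]
    calc _ ≤ 1 * q ^ n := by gcongr
      _ = _ := by rw [pow_succ]; field_simp

theorem norm_coeff_mobiusSeries_pow_le {q r : ℝ} (hq : 0 < q) (hq1 : q < 1) (hr : 0 ≤ r)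
    (hrq : r ≤ q) (m n : ℕ) :
    ‖PowerSeries.coeff n (mobiusSeries r ^ m)‖ ≤ (q⁻¹) ^ m * (n + 1) ^ m * q ^ n := by
  induction m generalizing n with
  | zero =>
    rw [pow_zero, PowerSeries.coeff_one]
    split_ifs with h
    · simp [h]
    · simp only [norm_zero]
      positivity
  | succ m ih =>
    rw [pow_succ, PowerSeries.coeff_mul]
    refine (norm_sum_le _ _).trans ?_
    calc _ ≤ ∑ p ∈ Finset.HasAntidiagonal.antidiagonal n, (q⁻¹) ^ (m + 1) * ((n : ℝ) + 1) ^ m * q ^ n := by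
          refine Finset.sum_le_sum fun p hp => ?_
          have hp' := Finset.HasAntidiagonal.mem_antidiagonal.1 hp
          rw [norm_mul]
          calc _ ≤ ((q⁻¹) ^ m * ((p.1 : ℝ) + 1) ^ m * q ^ p.1) * (q⁻¹ * q ^ p.2) := by
                gcongr
                · exact ih p.1
                · exact norm_coeff_mobiusSeries_le hq hq1 hr hrq _
            _ = (q⁻¹) ^ (m + 1) * ((p.1 : ℝ) + 1) ^ m * q ^ n := by
                rw [← hp', pow_add, pow_succ]
                ring
            _ ≤ _ := by
                gcongr
                lia
      _ = _ := by
          rw [Finset.sum_const, Finset.Nat.card_antidiagonal, nsmul_eq_mul, pow_succ _ m,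
            pow_succ _ m]
          push_cast
          ring

theorem exists_norm_coeff_mobiusPoly_le (a : ℕ → ℂ) (M : ℕ) {q : ℝ} (hq : 0 < q) (hq1 : q < 1) :
    ∃ L : ℝ, 0 ≤ L ∧ ∀ r : ℝ, 0 ≤ r → r ≤ q → ∀ n,
      ‖PowerSeries.coeff n (mobiusPoly a M r)‖ ≤ L * (n + 1) ^ M * q ^ n := by
  -- Every power `(n + 1) ^ m` with `m < M` is at most `(n + 1) ^ M`, so only the constants are
  -- summed.
  refine ⟨∑ m ∈ Finset.range M, ‖a m‖ * (q⁻¹) ^ m, by positivity, fun r hr hrq n => ?_⟩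
  rw [mobiusPoly, map_sum]
  refine (norm_sum_le _ _).trans ?_
  rw [Finset.sum_mul, Finset.sum_mul]
  refine Finset.sum_le_sum fun m hm => ?_
  rw [PowerSeries.coeff_C_mul, norm_mul, mul_assoc, mul_assoc]
  gcongr
  refine (norm_coeff_mobiusSeries_pow_le hq hq1 hr hrq m n).trans ?_
  rw [mul_assoc]
  gcongr
  · have : (0 : ℝ) ≤ n := by positivity
    linarith
  · exact (Finset.mem_range.1 hm).le

/-! ### The energy inequality for the field `1 - z²` -/

section Energy

variable {b : ℕ → ℝ} {ω : ℝ}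

/-- Summation by parts: each product of neighbours occurs twice, once from raising and once from
lowering the degree. The last one is left unpaired and becomes the boundary term. -/
theorem sum_hypDeriv_eq (b : ℕ → ℝ) (A : PowerSeries ℂ) (N : ℕ) :
    ∑ n ∈ Finset.range (N + 1), b n ^ 2 *
        ((starRingEnd ℂ) (PowerSeries.coeff n A) * PowerSeries.coeff n (hypDeriv A)).re =
      ∑ n ∈ Finset.range N, (b n ^ 2 * (n + 1) - b (n + 1) ^ 2 * n) *
        ((starRingEnd ℂ) (PowerSeries.coeff n A) * PowerSeries.coeff (n + 1) A).re +
      b N ^ 2 * (N + 1) *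
        ((starRingEnd ℂ) (PowerSeries.coeff N A) * PowerSeries.coeff (N + 1) A).re := by
  induction N with
  | zero => simp [-PowerSeries.coeff_zero_eq_constantCoeff, coeff_zero_hypDeriv]
  | succ N ih =>
    rw [Finset.sum_range_succ, ih, Finset.sum_range_succ _ N, coeff_succ_hypDeriv]
    simp
    ring

theorem sum_mul_succ_le (x : ℕ → ℝ) (N : ℕ) :
    ∑ n ∈ Finset.range N, x n * x (n + 1) ≤ ∑ n ∈ Finset.range (N + 1), x n ^ 2 - x N ^ 2 / 2 := by
  induction N with
  | zero => simp; nlinarith [sq_nonneg (x 0)]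
  | succ N ih =>
    rw [Finset.sum_range_succ, Finset.sum_range_succ _ (N + 1)]
    nlinarith [sq_nonneg (x N - x (N + 1))]

/-- The paired terms are at most `ω x_n x_{n+1}` with `x_n = b_n |A_n|`, and `2 x_n x_{n+1} ≤ x_n² +
x_{n+1}²`. -/
theorem sum_hypDeriv_le (hb : ∀ n, 0 ≤ b n) (hω : 0 ≤ ω)
    (h : ∀ n : ℕ, |b n ^ 2 * (n + 1) - b (n + 1) ^ 2 * n| ≤ ω * (b n * b (n + 1)))
    (A : PowerSeries ℂ) (N : ℕ) :
    ∑ n ∈ Finset.range (N + 1), b n ^ 2 *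
        ((starRingEnd ℂ) (PowerSeries.coeff n A) * PowerSeries.coeff n (hypDeriv A)).re ≤
      ω * ∑ n ∈ Finset.range (N + 1), b n ^ 2 * ‖PowerSeries.coeff n A‖ ^ 2 +
      b N ^ 2 * (N + 1) * (‖PowerSeries.coeff N A‖ * ‖PowerSeries.coeff (N + 1) A‖) := by
  have hre : ∀ n, |((starRingEnd ℂ) (PowerSeries.coeff n A) * PowerSeries.coeff (n + 1) A).re| ≤
      ‖PowerSeries.coeff n A‖ * ‖PowerSeries.coeff (n + 1) A‖ := fun n => by
    refine (Complex.abs_re_le_norm _).trans ?_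
    rw [norm_mul, RCLike.norm_conj]
  rw [sum_hypDeriv_eq]
  refine add_le_add ?_ ?_
  · set x : ℕ → ℝ := fun n => b n * ‖PowerSeries.coeff n A‖
    calc _ ≤ ∑ n ∈ Finset.range N, ω * (x n * x (n + 1)) := by
          refine Finset.sum_le_sum fun n _ => ?_
          refine (le_abs_self _).trans ?_
          rw [abs_mul]
          refine (mul_le_mul (h n) (hre n) (abs_nonneg _) ?_).trans (le_of_eq (by ring))
          exact mul_nonneg hω (mul_nonneg (hb _) (hb _))
      _ ≤ ω * ∑ n ∈ Finset.range (N + 1), x n ^ 2 := by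
          rw [← Finset.mul_sum]
          have := sum_mul_succ_le x N
          gcongr
          nlinarith [sq_nonneg (x N)]
      _ = _ := by simp only [x, mul_pow]
  · have := (le_abs_self _).trans (hre N)
    gcongr

end Energy

/-- The quantity equals `n (x - y)(x + y) + x²` with `x = β_n`, `y = β_{n+1}`. Here `n |x - y| ≤ M
x` by hypothesis; since this forces `β_{n+1} / β_n → 1`, also `x ≤ K y`. -/
theorem exists_weight_bound {β : Weight}
    (hsup : BddAbove (Set.range fun n : ℕ => (n : ℝ) * |1 - (β (n + 1) : ℝ) / (β n : ℝ)|)) :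
    ∃ ω : ℝ, 0 ≤ ω ∧ ∀ n : ℕ, |(β n : ℝ) ^ 2 * (n + 1) - (β (n + 1) : ℝ) ^ 2 * n| ≤
      ω * ((β n : ℝ) * β (n + 1)) := by
  obtain ⟨M, hM⟩ := hsup
  have hM' : ∀ n : ℕ, (n : ℝ) * |1 - (β (n + 1) : ℝ) / (β n : ℝ)| ≤ M := fun n => hM ⟨n, rfl⟩
  have hM0 : 0 ≤ M := by simpa using hM' 0
  have hlim : Tendsto (fun n : ℕ => (β (n + 1) : ℝ) / (β n : ℝ)) atTop (𝓝 1) := by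
    rw [tendsto_iff_dist_tendsto_zero]
    refine squeeze_zero' (Eventually.of_forall fun n => dist_nonneg) ?_
      (tendsto_const_div_atTop_nhds_zero_nat M)
    filter_upwards [eventually_gt_atTop 0] with n hn
    rw [le_div_iff₀ (by positivity), dist_comm, Real.dist_eq, mul_comm]
    exact hM' n
  obtain ⟨K, hK⟩ := (hlim.inv₀ one_ne_zero).bddAbove_range
  have hK' : ∀ n : ℕ, (β n : ℝ) ≤ K * β (n + 1) := fun n => by
    have h : ((β (n + 1) : ℝ) / (β n : ℝ))⁻¹ ≤ K := hK ⟨n, rfl⟩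
    rwa [inv_div, div_le_iff₀ (β (n + 1)).2] at h
  have hK0 : 0 ≤ K := by
    by_contra hneg
    nlinarith [hK' 0, (β 0).2, (β (0 + 1)).2]
  refine ⟨M * (K + 1) + K, by positivity, fun n => ?_⟩
  have hx := (β n).2
  have hy := (β (n + 1)).2
  have h1 := hM' n
  have h2 := hK' n
  set x : ℝ := (β n : ℝ)
  set y : ℝ := (β (n + 1) : ℝ)
  have h3 : (n : ℝ) * |x - y| ≤ M * x := by
    have : |x - y| = |1 - y / x| * x := by
      rw [← abs_of_pos hx, ← abs_mul, abs_of_pos hx]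
      congr 1
      field_simp
    rw [this, ← mul_assoc]
    gcongr
  calc |x ^ 2 * (n + 1) - y ^ 2 * n| = |n * (x - y) * (x + y) + x ^ 2| := by congr 1; ring
    _ ≤ n * |x - y| * (x + y) + x ^ 2 := by
        refine (abs_add_le _ _).trans (le_of_eq ?_)
        rw [abs_mul, abs_mul, abs_of_nonneg (Nat.cast_nonneg n), abs_of_pos (add_pos hx hy),
          abs_of_nonneg (sq_nonneg x)]
    _ ≤ M * x * (K * y + y) + x * (K * y) := by
        rw [sq]
        gcongr
    _ = _ := by ring

end WeightedHardy

namespace WeightedHardy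

/-! ### Integrating the energy inequality: a power bound for `C_{α_r}` -/

variable {b : ℕ → ℝ}

/-- The partial sums of the squared norm of `p ∘ mobius r`. -/
noncomputable def mobiusEnergy (b : ℕ → ℝ) (a : ℕ → ℂ) (M N : ℕ) (r : ℝ) : ℝ :=
  ∑ n ∈ Finset.range (N + 1), b n ^ 2 * ‖PowerSeries.coeff n (mobiusPoly a M r)‖ ^ 2

theorem one_sub_sq_ne_zero {r : ℝ} (hr : 0 < 1 - r ^ 2) : (1 : ℂ) - (r : ℂ) ^ 2 ≠ 0 := by
  exact_mod_cast hr.ne'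

theorem hasDerivAt_mobiusEnergy (b : ℕ → ℝ) (a : ℕ → ℂ) (M N : ℕ) {r : ℝ} (hr : 0 < 1 - r ^ 2) :
    HasDerivAt (mobiusEnergy b a M N)
      (2 / (1 - r ^ 2) * ∑ n ∈ Finset.range (N + 1), b n ^ 2 *
        ((starRingEnd ℂ) (PowerSeries.coeff n (mobiusPoly a M r)) *
          PowerSeries.coeff n (hypDeriv (mobiusPoly a M r))).re) r := by
  rw [Finset.mul_sum]
  refine HasDerivAt.fun_sum fun n _ => ?_
  refine (((hasDerivAt_coeff_mobiusPoly a M (one_sub_sq_ne_zero hr) n).norm_sq).const_mul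
    (b n ^ 2)).congr_deriv ?_
  have hcast : (1 : ℂ) - (r : ℂ) ^ 2 = ((1 - r ^ 2 : ℝ) : ℂ) := by push_cast; rfl
  rw [Complex.inner, hcast, div_mul_eq_mul_div, Complex.div_ofReal_re, mul_comm (starRingEnd ℂ _)]
  ring

/-- The integrating factor for `E' ≤ 2 (p + 1) E / (1 - r²)`. -/
theorem hasDerivAt_mobiusWeight (p : ℕ) {r : ℝ} (hr : r ∈ Set.Ioo (-1 : ℝ) 1) :
    HasDerivAt (fun r : ℝ => ((1 - r) / (1 + r)) ^ (p + 1))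
      (-(2 * (p + 1) / (1 - r ^ 2)) * ((1 - r) / (1 + r)) ^ (p + 1)) r := by
  have h1 : 1 + r ≠ 0 := by linarith [hr.1]
  have h2 : 1 - r ≠ 0 := by linarith [hr.2]
  have hd : HasDerivAt (fun r : ℝ => (1 - r) / (1 + r)) (-2 / (1 + r) ^ 2) r :=
    (((hasDerivAt_id' r).const_sub 1).fun_div ((hasDerivAt_id' r).const_add 1) h1).congr_deriv
      (by ring)
  refine (hd.fun_pow (p + 1)).congr_deriv ?_
  have h3 : 1 - r ^ 2 = (1 - r) * (1 + r) := by ring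
  rw [h3]
  simp only [Nat.add_sub_cancel, pow_succ]
  push_cast
  field_simp

/-- The differential inequality satisfied by `mobiusEnergy`, integrated. -/
theorem mobiusEnergy_le {ω ε q : ℝ} {p : ℕ} (hb : ∀ n, 0 ≤ b n) (hω : 0 ≤ ω) (hp : ω ≤ p + 1)
    (h : ∀ n : ℕ, |b n ^ 2 * (n + 1) - b (n + 1) ^ 2 * n| ≤ ω * (b n * b (n + 1)))
    (a : ℕ → ℂ) (M N : ℕ) (hq : 0 < q) (hq1 : q < 1)
    (hε : ∀ r, 0 ≤ r → r ≤ q → b N ^ 2 * (N + 1) *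
      (‖PowerSeries.coeff N (mobiusPoly a M r)‖ * ‖PowerSeries.coeff (N + 1) (mobiusPoly a M r)‖)
        ≤ ε) :
    ((1 - q) / (1 + q)) ^ (p + 1) * mobiusEnergy b a M N q ≤
      mobiusEnergy b a M N 0 + 2 * ε / (1 - q ^ 2) := by
  have hq2 : 0 < 1 - q ^ 2 := by nlinarith
  have hε0 : 0 ≤ ε := le_trans (by positivity) (hε 0 le_rfl hq.le)
  set w : ℝ → ℝ := fun r => ((1 - r) / (1 + r)) ^ (p + 1) with hw
  set E := mobiusEnergy b a M N with hE
  set S : ℝ → ℝ := fun r => ∑ n ∈ Finset.range (N + 1), b n ^ 2 *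
        ((starRingEnd ℂ) (PowerSeries.coeff n (mobiusPoly a M r)) *
          PowerSeries.coeff n (hypDeriv (mobiusPoly a M r))).re with hS
  have hpos : ∀ r ∈ Set.Icc 0 q, 0 < 1 - r ^ 2 := fun r hr => by nlinarith [hr.1, hr.2]
  have hd : ∀ r ∈ Set.Icc 0 q, HasDerivAt (fun r => w r * E r - 2 * ε / (1 - q ^ 2) * r)
      (-(2 * (p + 1) / (1 - r ^ 2)) * w r * E r + w r * (2 / (1 - r ^ 2) * S r)
        - 2 * ε / (1 - q ^ 2)) r := fun r hr => by
    have h1 := hasDerivAt_mobiusWeight p (r := r) ⟨by linarith [hr.1], by linarith [hr.2]⟩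
    have h2 := hasDerivAt_mobiusEnergy b a M N (hpos r hr)
    have h3 := (h1.mul h2).sub ((hasDerivAt_id r).const_mul (2 * ε / (1 - q ^ 2)))
    exact h3.congr_deriv (by rw [mul_one])
  -- The linear term compensates the boundary error, whose rate is at most `2ε / (1 - q²)` because
  -- `w ≤ 1` and `r ≤ q`.
  have hanti : AntitoneOn (fun r => w r * E r - 2 * ε / (1 - q ^ 2) * r) (Set.Icc 0 q) := by
    refine antitoneOn_of_deriv_nonpos (convex_Icc 0 q)
      (fun r hr => (hd r hr).continuousAt.continuousWithinAt)
      (fun r hr => (hd r (interior_subset hr)).differentiableAt.differentiableWithinAt)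
      fun r hr => ?_
    have hr' := interior_subset hr
    rw [(hd r hr').deriv]
    have hrp := hpos r hr'
    have hw0 : 0 ≤ w r := by
      have : 0 ≤ 1 - r := by linarith [hr'.2]
      have : 0 ≤ 1 + r := by linarith [hr'.1]
      positivity
    have hw1 : w r ≤ 1 := by
      have h1 : 0 ≤ 1 - r := by linarith [hr'.2]
      have h2 : 0 < 1 + r := by linarith [hr'.1]
      refine pow_le_one₀ (by positivity) ?_
      rw [div_le_one h2]
      linarith [hr'.1]
    have hE0 : 0 ≤ E r := Finset.sum_nonneg fun n _ => by positivity
    have hSr : S r ≤ (p + 1) * E r + ε := by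
      refine (sum_hypDeriv_le hb hω h _ N).trans ?_
      refine add_le_add ?_ (hε r hr'.1 hr'.2)
      exact mul_le_mul_of_nonneg_right hp hE0
    have hinv : 1 / (1 - r ^ 2) ≤ 1 / (1 - q ^ 2) := by
      refine one_div_le_one_div_of_le hq2 ?_
      nlinarith [hr'.1, hr'.2]
    have h1 : -(2 * (p + 1) / (1 - r ^ 2)) * w r * E r + w r * (2 / (1 - r ^ 2) * S r) ≤
        2 * (w r * ε) * (1 / (1 - r ^ 2)) := by
      have : w r * (2 / (1 - r ^ 2) * S r) ≤
          w r * (2 / (1 - r ^ 2) * ((p + 1) * E r + ε)) := by gcongr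
      refine (add_le_add_right this _).trans (le_of_eq ?_)
      field_simp
      ring
    have h2 : 2 * (w r * ε) * (1 / (1 - r ^ 2)) ≤ 2 * (1 * ε) * (1 / (1 - q ^ 2)) := by
      gcongr
    have h3 : 2 * (1 * ε) * (1 / (1 - q ^ 2)) = 2 * ε / (1 - q ^ 2) := by ring
    linarith
  have := hanti (Set.left_mem_Icc.2 hq.le) (Set.right_mem_Icc.2 hq.le) hq.le
  have hw0 : w 0 = 1 := by simp [hw]
  simp only [hw0, one_mul, mul_zero, sub_zero] at this
  have h4 : 2 * ε / (1 - q ^ 2) * q ≤ 2 * ε / (1 - q ^ 2) * 1 := by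
    gcongr
  linarith

/-- The geometric factor beats the polynomial growth. The factor `c * N` stands for the bound `β_N²
≤ β_1² N`. -/
theorem tendsto_boundary {c L q : ℝ} (M : ℕ) (hq : 0 < q) (hq1 : q < 1) :
    Tendsto (fun N : ℕ => c * N * (N + 1) *
      ((L * (N + 1) ^ M * q ^ N) * (L * (N + 2) ^ M * q ^ (N + 1)))) atTop (𝓝 0) := by
  have h := (tendsto_pow_const_mul_const_pow_of_abs_lt_one (2 * M + 2)
    (show |q| < 1 by rwa [abs_of_pos hq])).comp (tendsto_add_atTop_nat 2)
  have h' := h.const_mul (|c| * L ^ 2 * q⁻¹ ^ 2)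
  rw [mul_zero] at h'
  refine squeeze_zero_norm (fun N => ?_) h'
  have hN : (0 : ℝ) ≤ N := Nat.cast_nonneg N
  simp only [Function.comp_apply, Nat.cast_add, Nat.cast_ofNat, norm_mul, Real.norm_eq_abs,
    abs_pow, abs_of_pos hq, abs_of_nonneg hN, abs_of_nonneg (show (0 : ℝ) ≤ N + 1 by positivity),
    abs_of_nonneg (show (0 : ℝ) ≤ N + 2 by positivity)]
  have h1 : q ^ N * q ^ (N + 1) ≤ q ^ N := mul_le_of_le_one_right (by positivity)
    (pow_le_one₀ hq.le hq1.le)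
  calc _ = |c| * |L| ^ 2 * (N * (N + 1) * (N + 1) ^ M * (N + 2) ^ M) * (q ^ N * q ^ (N + 1)) := by
        ring
    _ ≤ |c| * |L| ^ 2 * ((N + 2) * (N + 2) * (N + 2) ^ M * (N + 2) ^ M) * q ^ N := by
        gcongr <;> linarith
    _ = _ := by
        rw [sq_abs, pow_add q N 2]
        field_simp
        ring

/-- The disc automorphisms satisfy a power estimate. -/
theorem exists_mobiusEstimate {β : Weight}
    (hmono : ∀ m n : ℕ, 1 ≤ m → m ≤ n →
      (β n : ℝ) / Real.sqrt n ≤ (β m : ℝ) / Real.sqrt m)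
    (hsup : BddAbove (Set.range fun n : ℕ => (n : ℝ) * |1 - (β (n + 1) : ℝ) / (β n : ℝ)|)) :
    ∃ a : ℝ, 0 ≤ a ∧ MobiusEstimate β a := by
  obtain ⟨ω, hω, hωb⟩ := exists_weight_bound hsup
  obtain ⟨p, hp⟩ := exists_nat_ge ω
  have hp' : ω ≤ p + 1 := by linarith
  -- The energy is a squared norm, hence half of its exponent.
  refine ⟨((p + 1 : ℕ) : ℝ) / 2, by positivity, fun q hq => ?_⟩
  have hT := isTaylor_mobius hq
  have hbase : 0 < (1 + q) / (1 - q) := div_pos (by linarith [hq.1]) (by linarith [hq.2])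
  have hβ : ∀ n : ℕ, 1 ≤ n → (β n : ℝ) ^ 2 ≤ (β 1 : ℝ) ^ 2 * n := fun n hn => by
    have h1 := hmono 1 n le_rfl hn
    rw [Nat.cast_one, Real.sqrt_one, div_one, div_le_iff₀ (by positivity)] at h1
    refine (pow_le_pow_left₀ (β n).2.le h1 2).trans ?_
    rw [mul_pow, Real.sq_sqrt (by positivity)]
  refine exists_isCompositionOperator hT.isHol (Real.rpow_nonneg hbase.le _) fun f N => ?_
  have hK : (((1 + q) / (1 - q)) ^ (((p + 1 : ℕ) : ℝ) / 2)) ^ 2 =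
      ((1 + q) / (1 - q)) ^ (p + 1) := by
    rw [← Real.rpow_natCast, ← Real.rpow_mul hbase.le, ← Real.rpow_natCast]
    congr 1
    push_cast
    ring
  rw [hK]
  -- First a Taylor polynomial of `f` with `M` terms: the energy cutoff `n` tends to infinity to
  -- remove the boundary error. Afterwards `M` tends to infinity with `N` fixed.
  have hpoly : ∀ M, ∑ n ∈ Finset.range N, ‖PowerSeries.coeff n
      (mobiusPoly (taylorCoeff f) M q)‖ ^ 2 * (β n : ℝ) ^ 2 ≤
        ((1 + q) / (1 - q)) ^ (p + 1) * ‖f‖ ^ 2 := fun M => by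
    obtain ⟨L, hL, hLb⟩ := exists_norm_coeff_mobiusPoly_le (taylorCoeff f) M hq.1 hq.2
    set ε : ℕ → ℝ := fun N => (β 1 : ℝ) ^ 2 * N * (N + 1) *
      ((L * (N + 1) ^ M * q ^ N) * (L * (N + 2) ^ M * q ^ (N + 1))) with hε
    have hE0 : ∀ n, mobiusEnergy (fun n => (β n : ℝ)) (taylorCoeff f) M n 0 ≤ ‖f‖ ^ 2 :=
        fun n => by
      refine le_trans (Finset.sum_le_sum fun k _ => ?_) (f.sum_le_norm_sq (Finset.range (n + 1)))
      rw [mobiusPoly, mobiusSeries_zero, coeff_sum_C_mul_X_pow, mul_comm]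
      gcongr
      split_ifs <;> simp
    have hbound : ∀ n, N ≤ n → 1 ≤ n → ∑ k ∈ Finset.range N, ‖PowerSeries.coeff k
        (mobiusPoly (taylorCoeff f) M q)‖ ^ 2 * (β k : ℝ) ^ 2 ≤
        ((1 + q) / (1 - q)) ^ (p + 1) * (‖f‖ ^ 2 + 2 * ε n / (1 - q ^ 2)) := fun n hn hn1 => by
      have h1 := mobiusEnergy_le (b := fun n => (β n : ℝ)) (fun n => (β n).2.le) hω hp' hωb
        (taylorCoeff f) M n hq.1 hq.2 (ε := ε n) fun r hr hrq => by
          have hc1 := hLb r hr hrq n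
          have hc2 := hLb r hr hrq (n + 1)
          push_cast at hc2
          rw [add_assoc, one_add_one_eq_two] at hc2
          have := hβ n hn1
          have hq0 := hq.1
          simp only [hε]
          gcongr
      have h2 : mobiusEnergy (fun n => (β n : ℝ)) (taylorCoeff f) M n q ≤
          ((1 + q) / (1 - q)) ^ (p + 1) * (‖f‖ ^ 2 + 2 * ε n / (1 - q ^ 2)) := by
        have h3 := h1.trans (add_le_add_left (hE0 n) _)
        have h4 := mul_le_mul_of_nonneg_left h3 (pow_nonneg hbase.le (p + 1))
        rwa [← mul_assoc, ← mul_pow, div_mul_div_cancel₀' (by linarith [hq.1]),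
          div_self (by linarith [hq.2]), one_pow, one_mul] at h4
      refine le_trans ?_ h2
      rw [mobiusEnergy]
      simp only [mul_comm ((β _ : ℝ) ^ 2)]
      exact Finset.sum_le_sum_of_subset_of_nonneg (Finset.range_mono (by lia))
        fun _ _ _ => by positivity
    have hlim : Tendsto (fun n => ((1 + q) / (1 - q)) ^ (p + 1) *
        (‖f‖ ^ 2 + 2 * ε n / (1 - q ^ 2))) atTop
        (𝓝 (((1 + q) / (1 - q)) ^ (p + 1) * (‖f‖ ^ 2 + 2 * 0 / (1 - q ^ 2)))) :=
      ((((tendsto_boundary M hq.1 hq.2).const_mul 2).div_const _).const_add _).const_mul _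
    rw [mul_zero, zero_div, add_zero] at hlim
    refine ge_of_tendsto hlim ?_
    filter_upwards [eventually_ge_atTop (max N 1)] with n hn
    exact hbound n (le_of_max_le_left hn) (le_of_max_le_right hn)
  have hlim : Tendsto (fun M => ∑ n ∈ Finset.range N, ‖PowerSeries.coeff n
      (mobiusPoly (taylorCoeff f) M q)‖ ^ 2 * (β n : ℝ) ^ 2) atTop
      (𝓝 (∑ n ∈ Finset.range N,
        ‖taylorCoeff (fun z => f (mobius q hq z)) n‖ ^ 2 * (β n : ℝ) ^ 2)) :=
    tendsto_finsetSum _ fun n _ =>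
      (((tendsto_coeff_comp f.2.1 hT n).norm).pow 2).mul_const _
  exact le_of_tendsto' hlim hpoly

end WeightedHardy

/-! ### Holomorphic flows: injectivity and behaviour for small times -/

namespace WeightedHardy

/-- Cauchy's formula bounds the Lipschitz constant of a holomorphic function on a smaller disc by
its mean on a circle. -/
theorem norm_sub_le_circle_integral {g : ℂ → ℂ} (hg : DifferentiableOn ℂ g (Metric.ball 0 1))
    {ρ σ : ℝ} (hρ : 0 ≤ ρ) (hρσ : ρ < σ) (hσ : σ < 1) {z w : ℂ} (hz : ‖z‖ ≤ ρ) (hw : ‖w‖ ≤ ρ) :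
    ‖g z - g w‖ ≤ (2 * Real.pi)⁻¹ * (σ / (σ - ρ) ^ 2 *
      (∫ θ in (0 : ℝ)..2 * Real.pi, ‖g (circleMap 0 σ θ)‖)) * ‖z - w‖ := by
  have hσ0 : 0 < σ := lt_of_le_of_lt hρ hρσ
  have hd : DiffContOnCl ℂ g (Metric.ball 0 |σ|) := by
    refine (hg.mono (Metric.closure_ball_subset_closedBall.trans ?_)).diffContOnCl
    exact Metric.closedBall_subset_ball (by rwa [abs_of_pos hσ0])
  have hsph : ∀ θ, ‖circleMap 0 σ θ‖ = σ := fun θ => by simp [abs_of_pos hσ0]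
  have hsub : ∀ {v : ℂ}, ‖v‖ ≤ ρ → ∀ θ, σ - ρ ≤ ‖circleMap 0 σ θ - v‖ := fun {v} hv θ => by
    have := norm_sub_norm_le (circleMap 0 σ θ) v
    rw [hsph] at this
    linarith
  have hne : ∀ {v : ℂ}, ‖v‖ ≤ ρ → ∀ θ, circleMap 0 σ θ - v ≠ 0 := fun hv θ =>
    norm_pos_iff.1 (by linarith [hsub hv θ])
  have hgc : Continuous fun θ => g (circleMap 0 σ θ) := by
    rw [← continuousOn_univ]
    exact hg.continuousOn.comp (continuous_circleMap 0 σ).continuousOn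
      fun θ _ => by simpa [hsph] using hσ
  have hform : ∀ {v : ℂ}, ‖v‖ ≤ ρ → g v = (2 * Real.pi)⁻¹ • ∫ θ in (0 : ℝ)..2 * Real.pi,
      circleMap 0 σ θ / (circleMap 0 σ θ - v) * g (circleMap 0 σ θ) := fun {v} hv => by
    have := hd.circleAverage_smul_div (w := v) (by
      rw [mem_ball_zero_iff, abs_of_pos hσ0]
      linarith)
    rw [← this, Real.circleAverage_def]
    simp
  have hint : ∀ {v : ℂ}, ‖v‖ ≤ ρ → IntervalIntegrable (fun θ =>
      circleMap 0 σ θ / (circleMap 0 σ θ - v) * g (circleMap 0 σ θ)) MeasureTheory.volume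
      0 (2 * Real.pi) := fun {v} hv => by
    refine Continuous.intervalIntegrable (Continuous.mul (Continuous.div ?_ ?_ (hne hv)) hgc) _ _
    · exact continuous_circleMap 0 σ
    · exact (continuous_circleMap 0 σ).sub continuous_const
  rw [hform hz, hform hw, ← smul_sub, ← intervalIntegral.integral_sub (hint hz) (hint hw),
    norm_smul, Real.norm_of_nonneg (by positivity), mul_assoc]
  gcongr
  rw [mul_assoc, mul_comm _ ‖z - w‖, ← mul_assoc, ← intervalIntegral.integral_const_mul]
  refine intervalIntegral.norm_integral_le_of_norm_le (by positivity)
    (MeasureTheory.ae_of_all _ fun θ _ => ?_)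
    ((continuous_const.mul hgc.norm).intervalIntegrable _ _)
  have h1 := hne hz θ
  have h2 := hne hw θ
  -- The difference of the two Cauchy kernels contains the factor `z - w`.
  have heq : circleMap 0 σ θ / (circleMap 0 σ θ - z) * g (circleMap 0 σ θ) -
      circleMap 0 σ θ / (circleMap 0 σ θ - w) * g (circleMap 0 σ θ) =
      circleMap 0 σ θ * (z - w) / ((circleMap 0 σ θ - z) * (circleMap 0 σ θ - w)) *
        g (circleMap 0 σ θ) := by
    field_simp
    ring
  rw [heq, norm_mul, norm_div, norm_mul, norm_mul, hsph]
  gcongr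
  rw [div_mul_eq_mul_div]
  have := sub_pos.2 hρσ
  gcongr
  rw [sq]
  exact mul_le_mul (hsub hz θ) (hsub hw θ) this.le (norm_nonneg _)

namespace IsHolomorphicFlow

variable {φ : ℝ≥0 → 𝔻 → 𝔻}

theorem continuous_apply (hφ : IsHolomorphicFlow φ) (z : 𝔻) : Continuous fun t => φ t z :=
  continuous_iff_continuousAt.2 fun s => hφ.tendsto s z

theorem tendsto_coe (hφ : IsHolomorphicFlow φ) (z : 𝔻) :
    Tendsto (fun t => (φ t z : ℂ)) (𝓝 0) (𝓝 z) := by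
  have := (Complex.UnitDisc.continuous_coe.tendsto _).comp (hφ.tendsto 0 z)
  rwa [hφ.zero] at this

/-- For small times the Lipschitz constant of `φ t - id` is small on compact sets. -/
theorem eventually_lipschitz (hφ : IsHolomorphicFlow φ) {ρ ε : ℝ} (hρ : 0 ≤ ρ) (hρ1 : ρ < 1)
    (hε : 0 < ε) : ∀ᶠ t in 𝓝 (0 : ℝ≥0), ∀ z w : 𝔻, ‖(z : ℂ)‖ ≤ ρ → ‖(w : ℂ)‖ ≤ ρ →
      ‖((φ t z : ℂ) - z) - ((φ t w : ℂ) - w)‖ ≤ ε * ‖(z : ℂ) - w‖ := by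
  obtain ⟨σ, hρσ, hσ⟩ := exists_between hρ1
  set g : ℝ≥0 → ℂ → ℂ := fun t z => extendZero (fun z => (φ t z : ℂ)) z - z with hg
  have hgd : ∀ t, DifferentiableOn ℂ (g t) (Metric.ball 0 1) := fun t =>
    DifferentiableOn.sub (hφ.isHol t) differentiableOn_id
  have hmem : ∀ θ, ‖circleMap 0 σ θ‖ < 1 := fun θ => by
    simpa [abs_of_nonneg (hρ.trans hρσ.le)] using hσ
  have hlim : Tendsto (fun t => ∫ θ in (0 : ℝ)..2 * Real.pi, ‖g t (circleMap 0 σ θ)‖) (𝓝 0)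
      (𝓝 (∫ θ in (0 : ℝ)..2 * Real.pi, (0 : ℝ))) := by
    -- Pointwise convergence suffices: `|φ_t(ζ) - ζ| ≤ 2` allows dominated convergence on the
    -- circle, and Cauchy's formula makes the result uniform.
    refine intervalIntegral.tendsto_integral_filter_of_dominated_convergence (fun _ => 2) ?_ ?_ ?_ ?_
    · refine Eventually.of_forall fun t => Continuous.aestronglyMeasurable ?_
      rw [← continuousOn_univ]
      exact ((hgd t).continuousOn.comp (continuous_circleMap 0 σ).continuousOn
        fun θ _ => by simpa using hmem θ).norm
    · refine Eventually.of_forall fun t => MeasureTheory.ae_of_all _ fun θ _ => ?_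
      rw [norm_norm]
      refine (norm_sub_le _ _).trans ?_
      linarith [norm_extendZero_lt_one (φ t) (circleMap 0 σ θ), hmem θ]
    · exact _root_.intervalIntegrable_const
    · refine MeasureTheory.ae_of_all _ fun θ _ => ?_
      have h := ((hφ.tendsto_coe (Complex.UnitDisc.mk _ (hmem θ))).sub_const (circleMap 0 σ θ)).norm
      simp only [Complex.UnitDisc.coe_mk, sub_self, norm_zero] at h
      refine h.congr fun t => ?_
      simp only [hg, extendZero, hmem θ, dif_pos]
  have hlim' := (hlim.const_mul (σ / (σ - ρ) ^ 2)).const_mul (2 * Real.pi)⁻¹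
  simp only [intervalIntegral.integral_zero, mul_zero] at hlim'
  filter_upwards [hlim'.eventually (eventually_le_nhds hε)] with t ht z w hz hw
  have h := norm_sub_le_circle_integral (hgd t) hρ hρσ hσ hz hw
  simp only [hg, extendZero_coe] at h
  exact h.trans (mul_le_mul_of_nonneg_right ht (norm_nonneg _))

/-- Take the first time `s` at which two orbits meet. For small `u > 0` the map `φ_u` is injective
on a disc containing both orbits at time `s - u`, since `φ_u - id` has Lipschitz constant `1/2`
there. So the orbits already met at `s - u`. -/
theorem injective (hφ : IsHolomorphicFlow φ) (t : ℝ≥0) : Function.Injective (φ t) := by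
  intro z w hzw
  by_contra hne
  set S : Set ℝ≥0 := {s | φ s z = φ s w}
  have hclosed : IsClosed S := by
    have h := isClosed_eq (Complex.UnitDisc.continuous_coe.comp (hφ.continuous_apply z))
      (Complex.UnitDisc.continuous_coe.comp (hφ.continuous_apply w))
    simpa [S, Complex.UnitDisc.coe_inj] using h
  have hmem : sInf S ∈ S := hclosed.csInf_mem ⟨t, hzw⟩ (OrderBot.bddBelow S)
  set s := sInf S with hs
  have hs0 : 0 < s := by
    refine pos_iff_ne_zero.2 fun h => hne ?_
    rw [h] at hmem
    have : φ 0 z = φ 0 w := hmem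
    rwa [hφ.zero, hφ.zero] at this
  obtain ⟨ρ, hρ, hρ1⟩ := exists_between (φ s z).norm_lt_one
  have hsub : Tendsto (fun u => s - u) (𝓝 (0 : ℝ≥0)) (𝓝 s) := by
    have h : Continuous fun u : ℝ≥0 => s - u := by fun_prop
    simpa using h.tendsto 0
  have hnear : ∀ v, φ s v = φ s z → ∀ᶠ u in 𝓝 (0 : ℝ≥0), ‖(φ (s - u) v : ℂ)‖ ≤ ρ := fun v hv => by
    have h := (((Complex.UnitDisc.continuous_coe.tendsto _).comp
      (hφ.tendsto s v)).comp hsub).norm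
    rw [hv] at h
    exact h.eventually (eventually_le_nhds hρ)
  have hev := (hφ.eventually_lipschitz ((norm_nonneg _).trans hρ.le) hρ1
    (show (0 : ℝ) < 1 / 2 by norm_num)).and ((hnear z rfl).and ((hnear w hmem.symm).and
      (eventually_le_nhds hs0)))
  obtain ⟨u, ⟨hlip, hz, hw, hus⟩, hu0⟩ :=
    ((hev.filter_mono nhdsWithin_le_nhds).and (self_mem_nhdsWithin (s := Set.Ioi 0))).exists
  have hval : ∀ v, φ u (φ (s - u) v) = φ s v := fun v => by
    rw [← hφ.add, add_tsub_cancel_of_le hus]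
  have h := hlip _ _ hz hw
  have heq : φ s z = φ s w := hmem
  rw [hval, hval, heq, sub_sub_sub_cancel_left, norm_sub_rev] at h
  have h0 : ‖(φ (s - u) z : ℂ) - φ (s - u) w‖ = 0 :=
    le_antisymm (by linarith) (norm_nonneg _)
  have hmem' : s - u ∈ S := Complex.UnitDisc.coe_injective (sub_eq_zero.1 (norm_eq_zero.1 h0))
  exact absurd (csInf_le (OrderBot.bddBelow S) hmem') (not_le.2 (tsub_lt_self hs0 hu0))

/-- The orbit of the origin leaves it with bounded speed. -/
theorem exists_norm_apply_zero_le (hφ : IsHolomorphicFlow φ) :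
    ∃ C : ℝ, 0 ≤ C ∧ ∀ᶠ t in 𝓝 (0 : ℝ≥0), ‖(φ t 0 : ℂ)‖ ≤ C * t := by
  obtain ⟨s, hs0, hs⟩ := (nhds_bot_basis_Iic (α := ℝ≥0)).eventually_iff.1
    (hφ.eventually_lipschitz (ρ := 1 / 2) (ε := 1 / 2) (by norm_num) (by norm_num) (by norm_num))
  have hs0' : (0 : ℝ) < s := by exact_mod_cast hs0
  -- With `y = φ_t 0` and `X u = φ_u 0`, the integral of `X (u + t) - X u = φ_u y - φ_u 0` over `[0,
  -- s]` is compared in two ways. Its norm is at most `2t`, because only the two ends of the shifted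
  -- interval survive. It is at least `s |y| / 2`, because `φ_u` is close to the identity. Hence
  -- `|y| ≤ 4t / s`, without differentiating the flow.
  refine ⟨4 / s, by positivity, ?_⟩
  have hsmall : ∀ᶠ t in 𝓝 (0 : ℝ≥0), ‖(φ t 0 : ℂ)‖ ≤ 1 / 2 := by
    have := (hφ.tendsto_coe 0).norm
    rw [Complex.UnitDisc.coe_zero, norm_zero] at this
    exact this.eventually (eventually_le_nhds (by norm_num))
  filter_upwards [hsmall] with t ht
  set X : ℝ → ℂ := fun u => (φ u.toNNReal 0 : ℂ) with hX
  have hXc : Continuous X := Complex.UnitDisc.continuous_coe.comp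
    ((hφ.continuous_apply 0).comp continuous_real_toNNReal)
  have hX1 : ∀ u, ‖X u‖ ≤ 1 := fun u => (φ u.toNNReal 0).norm_lt_one.le
  set y : ℂ := (φ t 0 : ℂ) with hy
  have hi : ∀ a b, IntervalIntegrable X MeasureTheory.volume a b := fun a b =>
    hXc.intervalIntegrable a b
  have hi' : IntervalIntegrable (fun u => X (u + t)) MeasureTheory.volume 0 s :=
    (hXc.comp (continuous_add_const _)).intervalIntegrable _ _
  have hupper : ‖(∫ u in (0 : ℝ)..s, X (u + t)) - ∫ u in (0 : ℝ)..s, X u‖ ≤ 2 * t := by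
    rw [intervalIntegral.integral_comp_add_right X,
      intervalIntegral.integral_interval_sub_interval_comm (hi _ _) (hi _ _) (hi _ _)]
    refine (norm_sub_le _ _).trans ?_
    have h1 := intervalIntegral.norm_integral_le_of_norm_le_const (f := X) (C := 1)
      (a := 0 + t) (b := 0) fun u _ => hX1 u
    have h2 := intervalIntegral.norm_integral_le_of_norm_le_const (f := X) (C := 1)
      (a := s + t) (b := s) fun u _ => hX1 u
    simp only [zero_add, zero_sub, abs_neg, NNReal.abs_eq, one_mul, sub_add_cancel_left] at h1 h2 ⊢
    linarith
  have hlower : ‖((∫ u in (0 : ℝ)..s, X (u + t)) - ∫ u in (0 : ℝ)..s, X u) - s * y‖ ≤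
      1 / 2 * ‖y‖ * s := by
    have hconst : (s : ℂ) * y = ∫ _ in (0 : ℝ)..s, y := by simp
    rw [← intervalIntegral.integral_sub hi' (hi _ _), hconst, ← intervalIntegral.integral_sub
      (hi'.sub (hi _ _)) _root_.intervalIntegrable_const]
    refine (intervalIntegral.norm_integral_le_of_norm_le_const (C := 1 / 2 * ‖y‖)
      fun u hu => ?_).trans (le_of_eq (by simp))
    rw [Set.uIoc_of_le hs0'.le] at hu
    have hus : u.toNNReal ∈ Set.Iic s := by
      rw [Set.mem_Iic, Real.toNNReal_le_iff_le_coe]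
      exact hu.2
    have h := hs hus (φ t 0) 0 ht (by norm_num)
    have hadd : X (u + t) = (φ u.toNNReal (φ t 0) : ℂ) := by
      simp only [hX]
      rw [Real.toNNReal_add hu.1.le t.coe_nonneg, Real.toNNReal_coe, hφ.add]
    rw [hadd]
    simp only [Complex.UnitDisc.coe_zero, sub_zero] at h
    rwa [sub_right_comm] at h
  rw [div_mul_eq_mul_div, le_div_iff₀ hs0']
  have h := norm_sub_norm_le (s * y) ((∫ u in (0 : ℝ)..s, X (u + t)) - ∫ u in (0 : ℝ)..s, X u)
  rw [norm_sub_rev (_ * y), norm_mul, show ‖(s : ℂ)‖ = s by simp] at h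
  linarith

/-- For small times `φ t` is uniformly close to the identity on compact sets. -/
theorem eventually_norm_sub_le (hφ : IsHolomorphicFlow φ) {ρ ε : ℝ} (hρ : 0 ≤ ρ) (hρ1 : ρ < 1)
    (hε : 0 < ε) : ∀ᶠ t in 𝓝 (0 : ℝ≥0), ∀ z : 𝔻, ‖(z : ℂ)‖ ≤ ρ → ‖(φ t z : ℂ) - z‖ ≤ ε := by
  have h0 := (hφ.tendsto_coe 0).norm
  rw [Complex.UnitDisc.coe_zero, norm_zero] at h0
  filter_upwards [hφ.eventually_lipschitz hρ hρ1 (half_pos hε),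
    h0.eventually (eventually_le_nhds (half_pos hε))] with t ht h0t z hz
  have h := ht z 0 hz (by simpa using hρ)
  simp only [Complex.UnitDisc.coe_zero, sub_zero] at h
  have h1 := norm_le_norm_sub_add ((φ t z : ℂ) - z) (φ t 0)
  nlinarith [z.norm_lt_one]

theorem tendsto_taylorCoeff (hφ : IsHolomorphicFlow φ) {f : 𝔻 → ℂ} (hf : IsHol f) (n : ℕ) :
    Tendsto (fun t => taylorCoeff (fun z => f (φ t z)) n) (𝓝 0) (𝓝 (taylorCoeff f n)) := by
  have h := IsTaylor.tendsto_coeff (l := 𝓝 (0 : ℝ≥0)) (ρ := 1 / 2)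
    (fun t => (hf.comp (hφ.isHol t)).isTaylor) hf.isTaylor (by norm_num) (by norm_num) ?_ n
  · simpa using h
  have huc : UniformContinuousOn (extendZero f) (Metric.closedBall 0 (3 / 4)) :=
    (isCompact_closedBall _ _).uniformContinuousOn_of_continuous
      (hf.continuousOn.mono (Metric.closedBall_subset_ball (by norm_num)))
  rw [Metric.tendstoUniformlyOn_iff]
  intro ε hε
  obtain ⟨δ, hδ, hδε⟩ := Metric.uniformContinuousOn_iff.1 huc ε hε
  filter_upwards [hφ.eventually_norm_sub_le (ρ := 1 / 2) (by norm_num) (by norm_num)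
    (lt_min (half_pos hδ) (show (0 : ℝ) < 1 / 4 by norm_num))] with t ht z hz
  have hz' : ‖z‖ = 1 / 2 := by simpa using hz
  have hz1 : ‖z‖ < 1 := by rw [hz']; norm_num
  have h := ht (Complex.UnitDisc.mk z hz1) hz'.le
  rw [Complex.UnitDisc.coe_mk] at h
  have hF : extendZero (fun w => (φ t w : ℂ)) z = φ t (Complex.UnitDisc.mk z hz1) := by
    simp [extendZero, hz1]
  rw [extendZero_comp f (φ t) hz1, hF]
  refine hδε _ (by rw [mem_closedBall_zero_iff, hz']; norm_num) _ ?_ ?_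
  · rw [mem_closedBall_zero_iff]
    have h1 := norm_le_norm_sub_add (φ t (Complex.UnitDisc.mk z hz1) : ℂ) z
    linarith [min_le_right (δ / 2) (1 / 4)]
  · rw [dist_comm, dist_eq_norm]
    linarith [min_le_left (δ / 2) (1 / 4)]

end IsHolomorphicFlow

/-! ### Norm convergence and the semigroup -/

namespace H2

variable {β : Weight}

theorem taylorCoeff_sub (f g : H2 β) (n : ℕ) :
    taylorCoeff (f - g : H2 β) n = taylorCoeff f n - taylorCoeff g n := by
  have h : ((f - g : H2 β) : 𝔻 → ℂ) = (f : 𝔻 → ℂ) + (-1 : ℂ) • (g : 𝔻 → ℂ) := by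
    rw [neg_one_smul, ← sub_eq_add_neg]
    rfl
  rw [h, taylorCoeff_add f.2.1 (g.2.1.smul _), taylorCoeff_smul]
  ring

/-- Beyond degree `N` use `|x - y|² ≤ 2|x|² + 2|y|²`; the tails are written as norm minus partial
sum, so that control of the norm of `g` controls its tail. -/
theorem norm_sub_sq_le (f g : H2 β) (N : ℕ) :
    ‖g - f‖ ^ 2 ≤
      ∑ n ∈ Finset.range N, ‖taylorCoeff g n - taylorCoeff f n‖ ^ 2 * (β n : ℝ) ^ 2 +
      (2 * (‖g‖ ^ 2 - ∑ n ∈ Finset.range N, ‖taylorCoeff g n‖ ^ 2 * (β n : ℝ) ^ 2) +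
      2 * (‖f‖ ^ 2 - ∑ n ∈ Finset.range N, ‖taylorCoeff f n‖ ^ 2 * (β n : ℝ) ^ 2)) := by
  have h1 := (hasSum_nat_add_iff' N).2 (g - f).hasSum_norm_sq
  have h2 := ((hasSum_nat_add_iff' N).2 g.hasSum_norm_sq).mul_left 2
  have h3 := ((hasSum_nat_add_iff' N).2 f.hasSum_norm_sq).mul_left 2
  simp only [taylorCoeff_sub] at h1
  rw [← sub_le_iff_le_add']
  refine hasSum_le (fun n => ?_) h1 (h2.add h3)
  rw [← mul_assoc, ← mul_assoc, ← add_mul]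
  gcongr
  have := norm_sub_le (taylorCoeff g (n + N)) (taylorCoeff f (n + N))
  refine (pow_le_pow_left₀ (norm_nonneg _) this 2).trans ?_
  nlinarith [sq_nonneg (‖taylorCoeff g (n + N)‖ - ‖taylorCoeff f (n + N)‖)]

/-- Coefficientwise convergence together with convergence of the norms is norm convergence. -/
theorem tendsto_of_tendsto_taylorCoeff {ι : Type*} {l : Filter ι} {g : ι → H2 β} {f : H2 β}
    {c : ι → ℝ} (hc : Tendsto c l (𝓝 1)) (hg : ∀ᶠ i in l, ‖g i‖ ≤ c i * ‖f‖)
    (h : ∀ n, Tendsto (fun i => taylorCoeff (g i) n) l (𝓝 (taylorCoeff f n))) :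
    Tendsto g l (𝓝 f) := by
  rw [Metric.tendsto_nhds]
  intro ε hε
  have hε2 : 0 < ε ^ 2 / 4 := by positivity
  obtain ⟨N, hN⟩ := (f.hasSum_norm_sq.tendsto_sum_nat.eventually
    (lt_mem_nhds (sub_lt_self (‖f‖ ^ 2) hε2))).exists
  set P := ∑ n ∈ Finset.range N, ‖taylorCoeff f n‖ ^ 2 * (β n : ℝ) ^ 2 with hP
  have h1 : Tendsto (fun i => ∑ n ∈ Finset.range N,
      ‖taylorCoeff (g i) n - taylorCoeff f n‖ ^ 2 * (β n : ℝ) ^ 2) l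
      (𝓝 (∑ n ∈ Finset.range N, ‖taylorCoeff f n - taylorCoeff f n‖ ^ 2 * (β n : ℝ) ^ 2)) :=
    tendsto_finsetSum _ fun n _ => ((((h n).sub_const _).norm).pow 2).mul_const _
  have h2 : Tendsto (fun i => ∑ n ∈ Finset.range N,
      ‖taylorCoeff (g i) n‖ ^ 2 * (β n : ℝ) ^ 2) l (𝓝 P) :=
    tendsto_finsetSum _ fun n _ => (((h n).norm).pow 2).mul_const _
  -- The limit of the upper bound is `4 (‖f‖² - P)`, which is below `ε²` by the choice of `N`.
  have h3 := h1.add ((((((hc.mul_const ‖f‖).pow 2).sub h2)).const_mul 2).add_const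
    (2 * (‖f‖ ^ 2 - P)))
  simp only [sub_self, norm_zero, ne_eq, OfNat.ofNat_ne_zero, not_false_eq_true, zero_pow,
    zero_mul, Finset.sum_const_zero, zero_add, one_mul] at h3
  filter_upwards [h3.eventually (gt_mem_nhds (show _ < ε ^ 2 by linarith)), hg] with i hi hgi
  have h4 := norm_sub_sq_le f (g i) N
  have h5 := pow_le_pow_left₀ (norm_nonneg _) hgi 2
  rw [dist_eq_norm]
  refine lt_of_pow_lt_pow_left₀ 2 hε.le ?_
  linarith

end H2

variable {β : Weight}

theorem IsCompositionOperator.ext {C D : H2 β →L[ℂ] H2 β} {φ : 𝔻 → 𝔻}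
    (hC : IsCompositionOperator C φ) (hD : IsCompositionOperator D φ) : C = D :=
  ContinuousLinearMap.ext fun f => Subtype.ext (funext fun z => (hC f z).trans (hD f z).symm)

/-- A semigroup of operators whose norm is at most `exp (ω t)` for small `t` is
quasicontractive. -/
theorem isQuasicontractive_of_eventually {E : Type*} [NormedAddCommGroup E] [NormedSpace ℂ E]
    {T : ℝ≥0 → E →L[ℂ] E} (h0 : T 0 = ContinuousLinearMap.id ℂ E)
    (hadd : ∀ t s, T (t + s) = (T t).comp (T s)) {ω : ℝ}
    (h : ∀ᶠ t in 𝓝 (0 : ℝ≥0), ‖T t‖ ≤ Real.exp (ω * t)) : IsQuasicontractive T := by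
  have hpow : ∀ (n : ℕ) (s : ℝ≥0), ‖T (n * s)‖ ≤ ‖T s‖ ^ n := fun n s => by
    induction n with
    | zero =>
      rw [Nat.cast_zero, zero_mul, h0, pow_zero]
      exact ContinuousLinearMap.norm_id_le
    | succ n ih =>
      rw [Nat.cast_succ, add_mul, one_mul, hadd, pow_succ]
      exact (ContinuousLinearMap.opNorm_comp_le _ _).trans (by gcongr)
  refine ⟨ω, fun t => ?_⟩
  have hlim : Tendsto (fun n : ℕ => t / (n : ℝ≥0)) atTop (𝓝 0) :=
    tendsto_const_div_atTop_nhds_zero_nat t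
  -- Split `t` into `n` steps short enough for the local bound.
  obtain ⟨n, hn, hn0⟩ := ((hlim.eventually h).and (eventually_gt_atTop 0)).exists
  have hn0' : (n : ℝ≥0) ≠ 0 := by exact_mod_cast hn0.ne'
  have h1 := hpow n (t / n)
  rw [mul_div_cancel₀ _ hn0'] at h1
  refine (h1.trans (pow_le_pow_left₀ (norm_nonneg _) hn n)).trans (le_of_eq ?_)
  rw [← Real.exp_nat_mul]
  congr 1
  have hn0'' : (n : ℝ) ≠ 0 := by exact_mod_cast hn0.ne'
  push_cast
  field_simp

theorem rpow_div_le_exp {a x : ℝ} (ha : 0 ≤ a) (hx : 0 ≤ x) (hx2 : x ≤ 1 / 2) :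
    ((1 + x) / (1 - x)) ^ a ≤ Real.exp (4 * a * x) := by
  have h1 : (1 + x) / (1 - x) ≤ Real.exp (4 * x) := by
    refine le_trans ?_ (Real.add_one_le_exp _)
    rw [div_le_iff₀ (by linarith)]
    nlinarith
  have h0 : 0 ≤ (1 + x) / (1 - x) := div_nonneg (by linarith) (by linarith)
  refine (Real.rpow_le_rpow h0 h1 ha).trans (le_of_eq ?_)
  rw [← Real.exp_mul]
  ring_nf

/-- If all univalent maps satisfy a power estimate, then holomorphic flows generate
quasicontractive semigroups. -/
theorem IsHolomorphicFlow.generatesQuasicontractive {a : ℝ} (ha : 0 ≤ a)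
    (hU : ∀ φ : 𝔻 → 𝔻, IsUnivalent φ → HasCompositionBound β a φ) {φ : ℝ≥0 → 𝔻 → 𝔻}
    (hφ : IsHolomorphicFlow φ) : GeneratesQuasicontractive β φ := by
  choose T hT hn using fun t => hU (φ t) ⟨hφ.isHol t, hφ.injective t⟩
  have h0 : T 0 = ContinuousLinearMap.id ℂ (H2 β) :=
    (hT 0).ext fun f z => by rw [hφ.zero]; rfl
  have hadd : ∀ t s, T (t + s) = (T t).comp (T s) := fun t s => by
    refine (hT (t + s)).ext ?_
    have h := (hT s).comp (hT t)
    -- Composition operators reverse the order of composition; commutativity of addition of times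
    -- restores it.
    have heq : (fun z => φ s (φ t z)) = φ (t + s) := by
      funext z
      rw [add_comm, hφ.add]
    rwa [heq] at h
  obtain ⟨C, hC, hev⟩ := hφ.exists_norm_apply_zero_le
  have hsmall : ∀ᶠ t in 𝓝 (0 : ℝ≥0), ‖(φ t 0 : ℂ)‖ ≤ 1 / 2 := by
    have := (hφ.tendsto_coe 0).norm
    rw [Complex.UnitDisc.coe_zero, norm_zero] at this
    exact this.eventually (eventually_le_nhds (by norm_num))
  have hexp : ∀ᶠ t in 𝓝 (0 : ℝ≥0), ‖T t‖ ≤ Real.exp (4 * a * C * t) := by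
    filter_upwards [hev, hsmall] with t ht ht2
    refine (hn t).trans ((rpow_div_le_exp ha (norm_nonneg _) ht2).trans ?_)
    rw [mul_assoc _ C]
    gcongr
  refine ⟨T, hT, ⟨h0, hadd, fun f => ?_⟩, isQuasicontractive_of_eventually h0 hadd hexp⟩
  refine Tendsto.mono_left ?_ nhdsWithin_le_nhds
  refine H2.tendsto_of_tendsto_taylorCoeff (c := fun t : ℝ≥0 => Real.exp (4 * a * C * t)) ?_ ?_ ?_
  · have : Continuous fun t : ℝ≥0 => Real.exp (4 * a * C * t) := by fun_prop
    simpa using this.tendsto 0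
  · filter_upwards [hexp] with t ht
    exact (T t).le_of_opNorm_le ht f
  · intro n
    refine (hφ.tendsto_taylorCoeff f.2.1 n).congr fun t => ?_
    congr 1
    funext z
    exact (hT t f z).symm

end WeightedHardy
theorem mainTheorem4 (β : WeightedHardy.Weight)
    (hmono : ∀ m n : ℕ, 1 ≤ m → m ≤ n →
      (β n : ℝ) / Real.sqrt n ≤ (β m : ℝ) / Real.sqrt m)
    (h01 : (β 1 : ℝ) ≤ (β 0 : ℝ))
    (hsup : BddAbove (Set.range fun n : ℕ => (n : ℝ) * |1 - (β (n + 1) : ℝ) / (β n : ℝ)|)) :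
    (∀ φ : ℝ≥0 → 𝔻 → 𝔻, WeightedHardy.IsHolomorphicFlow φ →
      WeightedHardy.GeneratesQuasicontractive β φ) ∧
    (∃ a : ℝ, 0 ≤ a ∧ ∀ φ : 𝔻 → 𝔻, WeightedHardy.IsUnivalent φ →
      WeightedHardy.HasCompositionBound β a φ) ∧
    (∀ a : ℝ, 0 ≤ a → WeightedHardy.MobiusEstimate β a →
      ∀ φ : 𝔻 → 𝔻, WeightedHardy.IsUnivalent φ →
        WeightedHardy.HasCompositionBound β a φ) := by
  obtain ⟨a, ha, hM⟩ := WeightedHardy.exists_mobiusEstimate hmono hsup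
  have hU : ∀ φ : 𝔻 → 𝔻, WeightedHardy.IsUnivalent φ → WeightedHardy.HasCompositionBound β a φ :=
    fun φ hφ => hφ.hasCompositionBound hmono hM
  exact ⟨fun φ hφ => hφ.generatesQuasicontractive ha hU, ⟨a, ha, hU⟩,
    fun b _ hMb φ hφ => hφ.hasCompositionBound hmono hMb⟩
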